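/- Let $f$ be a homeomorphism of a compact metric space $X$. For a set $\mathfrak N\subset\mathbb N=\{0,1,2,\dots\}$ and $x\in X$, the *$\mathfrak N$-empirical measures* of $x$ under $f$ are the weak-$*$ limit points, as $n\to\infty$, of the measures $\frac1n\sum_{j\in[0,n)\cap\mathfrak N}\delta_{f^j(x)}$. For a continuous function $\varphi\colon X\to\mathbb R$, $\alpha>0$ and $L\ge 1$, an *$(\alpha,L)$-neutral block* of $(x,f,\varphi)$ is an interval of integers $(n_0,n_0+1,\dots,n_1-1)$ such that $n_1-n_0\ge L$ and $\sum_{j=n_0}^{n-1}\varphi(f^j(x))\le\alpha\,(n-n_0)$ for all $n_0<n\le n_1$. Let $\mathfrak N_{\alpha,L}(x,f,\varphi)\subset\mathbb Z$ be the union of all $(\alpha,L)$-neutral blocks of $(x,f,\varphi)$; below, its empirical measures are those of its intersection with $\mathbb N$. **Proposition.** Let $f,f_1,f_2,\dots$ be homeomorphisms of a compact metric space $X$ and let $\varphi,\varphi_1,\varphi_2,\dots$ be continuous real-valued functions on $X$ such that $f_k\to f$ and $\varphi_k\to\varphi$ uniformly. For each $k$ let $\nu_k$ be an ergodic $f_k$-invariant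 Borel probability measure such that $\int\varphi_k\,d\nu_k\ge 0$. Then there exist a subsequence $(\nu_{k_i})$ and finite positive Borel measures $m_0,m_1$ on $X$ such that: (i) both $m_0$ and $m_1$ are $f$-invariant; (ii) $(\nu_{k_i})$ converges weak-$*$ to $m_0+m_1$; (iii) for all weak-$*$ neighborhoods $V_0$ of $m_0$ and $V_1$ of $m_1$ there exist $\alpha_*>0$ and $L_*\ge1$ such that for all $0<\alpha<\alpha_*$ and $L\ge L_*$ there is $i_*$ such that for all $i\ge i_*$ and $\nu_{k_i}$-a.e. $x$, all the $\mathfrak N_{\alpha,L}(x,f_{k_i},\varphi_{k_i})$-empirical measures of $x$ under $f_{k_i}$ belong to $V_0$, and all the $(\mathbb N\setminus\mathfrak N_{\alpha,L}(x,f_{k_i},\varphi_{k_i}))$-empirical measures of $x$ under $f_{k_i}$ belong to $V_1$; (iv) $\int\varphi\,dm_0=0$; (v) for $m_1$-a.e. $x$, the limit $\lim_{n\to\infty}\frac1n\sum_{j=0}^{n-1}\varphi(f^j(x))$ exists and is positive. -/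

import Mathlib

open MeasureTheory Filter Topology
open scoped NNReal

/-- The interval of integers `(n₀, n₀ + 1, …, n₁ - 1)` is an `(α, L)`-neutral block of `(x, f, φ)`:
its length is at least `L`, and the sum of `φ` along each of its non-empty initial segments
`(n₀, …, n - 1)` is at most `α * (n - n₀)`. -/
def IsNeutralBlock {X : Type*} [TopologicalSpace X] (α L : ℝ) (x : X) (f : X ≃ₜ X) (φ : X → ℝ)
    (n₀ n₁ : ℤ) : Prop :=
  L ≤ (n₁ : ℝ) - (n₀ : ℝ) ∧
    ∀ n : ℤ, n₀ < n → n ≤ n₁ →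
      ∑ j ∈ Finset.Ico n₀ n, φ ((f ^ j) x) ≤ α * ((n : ℝ) - (n₀ : ℝ))

/-- The union of all `(α, L)`-neutral blocks of `(x, f, φ)`. -/
def neutralSet {X : Type*} [TopologicalSpace X] (α L : ℝ) (x : X) (f : X ≃ₜ X) (φ : X → ℝ) :
    Set ℤ :=
  {j | ∃ n₀ n₁ : ℤ, IsNeutralBlock α L x f φ n₀ n₁ ∧ n₀ ≤ j ∧ j < n₁}

/-- The set of natural numbers that belong to some `(α, L)`-neutral block of `(x, f, φ)`. -/
def neutralTimes {X : Type*} [TopologicalSpace X] (α L : ℝ) (x : X) (f : X ≃ₜ X) (φ : X → ℝ) :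
    Set ℕ :=
  {j | (j : ℤ) ∈ neutralSet α L x f φ}

open Classical in
/-- The measure `(1 / n) ∑_{j ∈ [0, n) ∩ N} δ_{f^j(x)}`. -/
noncomputable def partialEmpirical {X : Type*} [TopologicalSpace X] [MeasurableSpace X]
    (f : X ≃ₜ X) (N : Set ℕ) (x : X) (n : ℕ) : FiniteMeasure X :=
  (n : ℝ≥0)⁻¹ • ∑ j ∈ (Finset.range n).filter (fun j => j ∈ N),
    (diracProba (f^[j] x)).toFiniteMeasure

/-- The `N`-empirical measures of `x`: the weak-* limit points of the sequence
`(1 / n) ∑_{j ∈ [0, n) ∩ N} δ_{f^j(x)}`. -/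
def empiricalMeasures {X : Type*} [TopologicalSpace X] [MeasurableSpace X] [OpensMeasurableSpace X]
    (f : X ≃ₜ X) (N : Set ℕ) (x : X) : Set (FiniteMeasure X) :=
  {m | MapClusterPt m atTop (fun n : ℕ => partialEmpirical f N x n)}

/-! A time `j` is neutral for `x` exactly when `f ^ j` takes `x` into a measurable set N(α, L),
`neutralLocus`. By ergodicity, the two kinds of empirical measures of almost every point are
therefore the restrictions of ν_k to N and to its complement (`ae_empiricalMeasures_subset`). The
sets N shrink as α ↓ 0 and L ↑ ∞, and m₀ is the limit of ν_k restricted to N, first in k and then in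
(α, L); m₁ is the rest of the limit of ν_k.

Three estimates control N. Components of the set of neutral times have length at least L, so an
orbit enters N with frequency at most 1/L; hence ν_k restricted to N is almost invariant. Neutral
blocks have averages at most α, so the integral of φ_k over N is at most α. Finally, a component
that ends cannot be prolonged by one step, so its sum of φ_k is bounded below by a constant; ends
have frequency at most 1/L, so the integral over N is at least -C/L. If N has full measure, the last
bound comes instead from the integral of φ_k being nonnegative. In the limit m₀ is invariant and φ
has integral zero.

For positivity on m₁, suppose the averages of φ at `x` tend to some l ≤ 0. Past a suitable time all
sums of φ stay strictly below slope α, so the orbit eventually stays in open sets defined by strict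
neutral blocks. By recurrence these sets cover almost all such points, and each of them lies in N
for all large k. A weak limit of what lies outside N thus gives them no mass. The limits for all
parameters are taken together by lifting ν_k to X × {0,1}^ℕ, where the sets N become clopen
cylinders (`exists_subseq_tendsto_restrict`). -/

/-! ### Maximal and pointwise ergodic theorems for bounded functions -/

section Birkhoff

variable {X : Type*} {T : X → X} {g : X → ℝ}

/-- The maximum of the Birkhoff sums of `g` over the times `0, …, n`. -/
noncomputable def maxBirkhoffSum (T : X → X) (g : X → ℝ) : ℕ → X → ℝ
  | 0, _ => 0
  | n + 1, x => max 0 (g x + maxBirkhoffSum T g n (T x))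

theorem maxBirkhoffSum_nonneg (n : ℕ) (x : X) : 0 ≤ maxBirkhoffSum T g n x := by
  cases n with
  | zero => exact le_rfl
  | succ n => exact le_max_left _ _

theorem maxBirkhoffSum_le_succ (n : ℕ) (x : X) :
    maxBirkhoffSum T g n x ≤ maxBirkhoffSum T g (n + 1) x := by
  induction n generalizing x with
  | zero => exact le_max_left _ _
  | succ n ih =>
    exact max_le_max le_rfl (add_le_add le_rfl (ih (T x)))

theorem birkhoffSum_le_maxBirkhoffSum (n : ℕ) (x : X) :
    birkhoffSum T g n x ≤ maxBirkhoffSum T g n x := by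
  induction n generalizing x with
  | zero => simp [maxBirkhoffSum]
  | succ n ih =>
    rw [birkhoffSum_succ']
    exact (add_le_add le_rfl (ih (T x))).trans (le_max_right _ _)

/-- Garsia's inequality: where the maximum is positive it equals `g` plus an earlier maximum at `T
x`, and elsewhere it is zero. Integrating kills the left-hand side by invariance. -/
theorem maxBirkhoffSum_sub_comp_le (n : ℕ) (x : X) :
    maxBirkhoffSum T g n x - maxBirkhoffSum T g n (T x) ≤
      {x | 0 < maxBirkhoffSum T g n x}.indicator g x := by
  by_cases hx : 0 < maxBirkhoffSum T g n x
  · rw [Set.indicator_of_mem (by exact hx)]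
    cases n with
    | zero => exact absurd hx (lt_irrefl _)
    | succ n =>
      have h1 : maxBirkhoffSum T g (n + 1) x = g x + maxBirkhoffSum T g n (T x) := by
        change 0 < max 0 (g x + maxBirkhoffSum T g n (T x)) at hx
        change max 0 (g x + maxBirkhoffSum T g n (T x)) = _
        exact max_eq_right ((lt_max_iff.1 hx).resolve_left (lt_irrefl _)).le
      have h2 := maxBirkhoffSum_le_succ (T := T) (g := g) n (T x)
      linarith
  · rw [Set.indicator_of_notMem (by exact hx)]
    have := maxBirkhoffSum_nonneg (T := T) (g := g) n (T x)
    linarith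

theorem abs_birkhoffAverage_le {C : ℝ} (hC : ∀ x, |g x| ≤ C) (n : ℕ) (x : X) :
    |birkhoffAverage ℝ T g n x| ≤ C := by
  have hC0 : 0 ≤ C := (abs_nonneg _).trans (hC x)
  rw [birkhoffAverage, smul_eq_mul, abs_mul, abs_inv, Nat.abs_cast]
  have : |birkhoffSum T g n x| ≤ n * C := by
    refine (Finset.abs_sum_le_sum_abs _ _).trans ?_
    refine (Finset.sum_le_card_nsmul _ _ C fun i _ => hC _).trans ?_
    simp
  rcases Nat.eq_zero_or_pos n with rfl | hn
  · simpa using hC0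
  · rw [inv_mul_le_iff₀ (by exact_mod_cast hn)]
    exact this

theorem isBoundedUnder_of_abs_le {u : ℕ → ℝ} {C : ℝ} (hu : ∀ n, |u n| ≤ C) :
    IsBoundedUnder (· ≤ ·) atTop u ∧ IsCoboundedUnder (· ≤ ·) atTop u :=
  ⟨isBoundedUnder_of ⟨C, fun n => (abs_le.1 (hu n)).2⟩,
    (isBoundedUnder_of (r := (· ≥ ·)) ⟨-C, fun n => (abs_le.1 (hu n)).1⟩).isCoboundedUnder_le⟩

theorem limsup_le_limsup_of_tendsto_sub {u v : ℕ → ℝ} {C : ℝ} (hu : ∀ n, |u n| ≤ C)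
    (hv : ∀ n, |v n| ≤ C) (h : Tendsto (fun n => u n - v n) atTop (𝓝 0)) :
    limsup u atTop ≤ limsup v atTop := by
  refine le_of_forall_pos_le_add fun ε hε => ?_
  have h1 : ∀ᶠ n in atTop, v n < limsup v atTop + ε / 2 :=
    eventually_lt_of_limsup_lt (by linarith) (isBoundedUnder_of_abs_le hv).1
  have h2 : ∀ᶠ n in atTop, u n - v n < ε / 2 := h.eventually_lt_const (by linarith)
  refine limsup_le_of_le (isBoundedUnder_of_abs_le hu).2 ?_
  filter_upwards [h1, h2] with n h1 h2
  linarith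

theorem abs_limsup_le {u : ℕ → ℝ} {C : ℝ} (hu : ∀ n, |u n| ≤ C) : |limsup u atTop| ≤ C := by
  obtain ⟨h1, h2⟩ := isBoundedUnder_of_abs_le hu
  refine abs_le.2 ⟨?_, ?_⟩
  · exact le_limsup_of_frequently_le (Frequently.of_forall fun n => (abs_le.1 (hu n)).1) h1
  · exact limsup_le_of_le h2 (Eventually.of_forall fun n => (abs_le.1 (hu n)).2)

theorem limsup_birkhoffAverage_apply {C : ℝ} (hC : ∀ x, |g x| ≤ C) (x : X) :
    limsup (fun n => birkhoffAverage ℝ T g n (T x)) atTop =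
      limsup (fun n => birkhoffAverage ℝ T g n x) atTop := by
  have hb : Bornology.IsBounded (Set.range g) :=
    isBounded_iff_forall_norm_le.2 ⟨C, by rintro _ ⟨y, rfl⟩; exact hC y⟩
  have h := tendsto_birkhoffAverage_apply_sub_birkhoffAverage' ℝ hb T x
  refine le_antisymm (limsup_le_limsup_of_tendsto_sub (C := C) (fun n => abs_birkhoffAverage_le hC _ _)
    (fun n => abs_birkhoffAverage_le hC _ _) h) (limsup_le_limsup_of_tendsto_sub (C := C)
    (fun n => abs_birkhoffAverage_le hC _ _) (fun n => abs_birkhoffAverage_le hC _ _) ?_)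
  simpa using h.neg

variable [MeasurableSpace X] {μ : Measure X}

theorem measurable_maxBirkhoffSum (hT : Measurable T) (hg : Measurable g) (n : ℕ) :
    Measurable (maxBirkhoffSum T g n) := by
  induction n with
  | zero => exact measurable_const
  | succ n ih => exact measurable_const.max (hg.add (ih.comp hT))

theorem integrable_maxBirkhoffSum (hT : MeasurePreserving T μ μ) (hg : Integrable g μ) (n : ℕ) :
    Integrable (maxBirkhoffSum T g n) μ := by
  induction n with
  | zero => exact integrable_zero _ _ _
  | succ n ih =>
    exact (integrable_zero _ _ _).sup (hg.add (hT.integrable_comp_of_integrable ih))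

theorem setIntegral_maxBirkhoffSum_pos_nonneg (hT : MeasurePreserving T μ μ) (hgm : Measurable g)
    (hg : Integrable g μ) (n : ℕ) : 0 ≤ ∫ x in {x | 0 < maxBirkhoffSum T g n x}, g x ∂μ := by
  have hm : MeasurableSet {x | 0 < maxBirkhoffSum T g n x} :=
    measurableSet_lt measurable_const (measurable_maxBirkhoffSum hT.measurable hgm n)
  have hi := integrable_maxBirkhoffSum hT hg n
  have hi' := hT.integrable_comp_of_integrable hi
  rw [← integral_indicator hm]
  calc (0 : ℝ) = ∫ x, (maxBirkhoffSum T g n x - maxBirkhoffSum T g n (T x)) ∂μ := by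
        have h2 : ∫ x, maxBirkhoffSum T g n (T x) ∂μ = ∫ x, maxBirkhoffSum T g n x ∂μ := by
          conv_rhs => rw [← hT.map_eq]
          rw [integral_map hT.measurable.aemeasurable]
          exact (measurable_maxBirkhoffSum hT.measurable hgm n).aestronglyMeasurable
        rw [integral_sub hi (by exact hi'), h2, sub_self]
    _ ≤ _ := integral_mono (hi.sub hi') (hg.indicator hm) (maxBirkhoffSum_sub_comp_le n)

/-- A form of the maximal ergodic theorem. -/
theorem integral_nonneg_of_exists_birkhoffSum_pos (hT : MeasurePreserving T μ μ)
    (hgm : Measurable g) (hg : Integrable g μ) (h : ∀ x, ∃ n, 0 < birkhoffSum T g n x) :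
    0 ≤ ∫ x, g x ∂μ := by
  have hm : ∀ n, MeasurableSet {x | 0 < maxBirkhoffSum T g n x} := fun n =>
    measurableSet_lt measurable_const (measurable_maxBirkhoffSum hT.measurable hgm n)
  have hmono : Monotone fun n => {x | 0 < maxBirkhoffSum T g n x} :=
    monotone_nat_of_le_succ fun n x hx => lt_of_lt_of_le hx (maxBirkhoffSum_le_succ n x)
  have hU : ⋃ n, {x | 0 < maxBirkhoffSum T g n x} = Set.univ := by
    refine Set.eq_univ_of_forall fun x => Set.mem_iUnion.2 ?_
    obtain ⟨n, hn⟩ := h x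
    exact ⟨n, hn.trans_le (birkhoffSum_le_maxBirkhoffSum n x)⟩
  have := tendsto_setIntegral_of_monotone hm hmono (f := g) (μ := μ) hg.integrableOn
  rw [hU, setIntegral_univ] at this
  exact ge_of_tendsto' this fun n => setIntegral_maxBirkhoffSum_pos_nonneg hT hgm hg n

theorem measurable_birkhoffAverage (hT : Measurable T) (hg : Measurable g) (n : ℕ) :
    Measurable (birkhoffAverage ℝ T g n) := by
  have : Measurable (birkhoffSum T g n) := by
    unfold birkhoffSum
    exact Finset.measurable_sum _ fun i _ => hg.comp (hT.iterate i)
  exact this.const_smul (n : ℝ)⁻¹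

theorem measurable_limsup_birkhoffAverage (hT : Measurable T) (hg : Measurable g) :
    Measurable fun x => limsup (fun n => birkhoffAverage ℝ T g n x) atTop :=
  Measurable.limsup fun n => measurable_birkhoffAverage hT hg n

theorem integrable_of_abs_le [IsFiniteMeasure μ] (hg : Measurable g) {C : ℝ}
    (hC : ∀ x, |g x| ≤ C) : Integrable g μ :=
  Integrable.of_bound hg.aestronglyMeasurable C (Eventually.of_forall hC)

/-- The upper limit `G` is invariant, so the Birkhoff sums of `g - (G - ε)` are those of `g` minus
`n * (G - ε)`, and one of them is positive at every point. The maximal ergodic theorem applies; then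
ε → 0. -/
theorem integral_limsup_birkhoffAverage_le [IsFiniteMeasure μ] (hT : MeasurePreserving T μ μ)
    (hgm : Measurable g) {C : ℝ} (hC : ∀ x, |g x| ≤ C) :
    ∫ x, limsup (fun n => birkhoffAverage ℝ T g n x) atTop ∂μ ≤ ∫ x, g x ∂μ := by
  set G : X → ℝ := fun x => limsup (fun n => birkhoffAverage ℝ T g n x) atTop with hG
  have hGm : Measurable G := measurable_limsup_birkhoffAverage hT.measurable hgm
  have hGC : ∀ x, |G x| ≤ C := fun x => abs_limsup_le fun n => abs_birkhoffAverage_le hC n x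
  have hGT : G ∘ T = G := funext fun x => limsup_birkhoffAverage_apply hC x
  have hgi := integrable_of_abs_le (μ := μ) hgm hC
  have hGi := integrable_of_abs_le (μ := μ) hGm hGC
  have key : ∀ ε : ℝ, 0 < ε → ∫ x, G x ∂μ ≤ ∫ x, g x ∂μ + ε * μ.real Set.univ := by
    intro ε hε
    have hpos : 0 ≤ ∫ x, (g - (G - fun _ => ε) : X → ℝ) x ∂μ := by
      refine integral_nonneg_of_exists_birkhoffSum_pos hT (hgm.sub (hGm.sub measurable_const))
        (hgi.sub (hGi.sub (integrable_const ε))) fun x => ?_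
      have hf : ∃ᶠ n in atTop, G x - ε < birkhoffAverage ℝ T g n x :=
        frequently_lt_of_lt_limsup
          (isBoundedUnder_of_abs_le fun n => abs_birkhoffAverage_le hC n x).2 (by simp [G, hε])
      obtain ⟨n, hn, hn1⟩ := (hf.and_eventually (eventually_ge_atTop 1)).exists
      refine ⟨n, ?_⟩
      have hn0 : (0 : ℝ) < n := by exact_mod_cast hn1
      have hc : (G - fun _ => ε) ∘ T = G - fun _ => ε := by
        funext y; simpa using congrFun hGT y
      rw [birkhoffSum_sub, birkhoffSum_of_comp_eq hc]
      rw [birkhoffAverage, smul_eq_mul, lt_inv_mul_iff₀ hn0] at hn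
      simp only [Pi.smul_apply, Pi.sub_apply, nsmul_eq_mul]
      linarith
    rw [integral_sub' hgi (hGi.sub (integrable_const ε)),
      integral_sub' hGi (integrable_const ε), integral_const, smul_eq_mul] at hpos
    linarith
  have hlim : Tendsto (fun ε : ℝ => ∫ x, g x ∂μ + ε * μ.real Set.univ) (𝓝[>] 0)
      (𝓝 (∫ x, g x ∂μ)) := by
    have : Continuous fun ε : ℝ => ∫ x, g x ∂μ + ε * μ.real Set.univ := by fun_prop
    simpa using (this.tendsto 0).mono_left nhdsWithin_le_nhds
  exact ge_of_tendsto hlim (eventually_mem_nhdsWithin.mono key)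

/-- **Birkhoff's pointwise ergodic theorem** for bounded functions. -/
theorem ae_tendsto_birkhoffAverage [IsFiniteMeasure μ] (hT : MeasurePreserving T μ μ)
    (hgm : Measurable g) {C : ℝ} (hC : ∀ x, |g x| ≤ C) :
    ∃ G : X → ℝ, Measurable G ∧ (∀ x, G (T x) = G x) ∧ ∫ x, G x ∂μ = ∫ x, g x ∂μ ∧
      ∀ᵐ x ∂μ, Tendsto (fun n => birkhoffAverage ℝ T g n x) atTop (𝓝 (G x)) := by
  set G : X → ℝ := fun x => limsup (fun n => birkhoffAverage ℝ T g n x) atTop with hG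
  -- `-H` is the lower limit of the averages of `g`. Since `G + H` is pointwise nonnegative with
  -- nonpositive integral, both limits agree almost everywhere.
  set H : X → ℝ := fun x => limsup (fun n => birkhoffAverage ℝ T (-g) n x) atTop with hH
  have hC' : ∀ x, |(-g) x| ≤ C := fun x => by simpa using hC x
  have hGm : Measurable G := measurable_limsup_birkhoffAverage hT.measurable hgm
  have hHm : Measurable H := measurable_limsup_birkhoffAverage hT.measurable hgm.neg
  have hGi := integrable_of_abs_le (μ := μ) hGm fun x =>
    abs_limsup_le fun n => abs_birkhoffAverage_le (T := T) hC n x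
  have hHi := integrable_of_abs_le (μ := μ) hHm fun x =>
    abs_limsup_le fun n => abs_birkhoffAverage_le (T := T) hC' n x
  have hG1 : ∫ x, G x ∂μ ≤ ∫ x, g x ∂μ := integral_limsup_birkhoffAverage_le hT hgm hC
  have hH1 : ∫ x, H x ∂μ ≤ ∫ x, (-g) x ∂μ := integral_limsup_birkhoffAverage_le hT hgm.neg hC'
  rw [integral_neg'] at hH1
  have hup : ∀ x, ∀ ε > 0, ∀ᶠ n in atTop, birkhoffAverage ℝ T g n x < G x + ε := fun x ε hε =>
    eventually_lt_of_limsup_lt (by simp [G, hε])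
      (isBoundedUnder_of_abs_le fun n => abs_birkhoffAverage_le hC n x).1
  have hlow : ∀ x, ∀ ε > 0, ∀ᶠ n in atTop, -H x - ε < birkhoffAverage ℝ T g n x := by
    intro x ε hε
    have : ∀ᶠ n in atTop, birkhoffAverage ℝ T (-g) n x < H x + ε :=
      eventually_lt_of_limsup_lt (by simp [H, hε])
        (isBoundedUnder_of_abs_le fun n => abs_birkhoffAverage_le hC' n x).1
    filter_upwards [this] with n hn
    rw [birkhoffAverage_neg, Pi.neg_apply, Pi.neg_apply] at hn
    linarith
  have hGH : ∀ x, 0 ≤ (G + H) x := by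
    intro x
    refine le_of_forall_pos_le_add fun ε hε => ?_
    obtain ⟨n, h1, h2⟩ := ((hup x (ε / 2) (by linarith)).and (hlow x (ε / 2) (by linarith))).exists
    simp only [Pi.add_apply]
    linarith
  have hsum : ∫ x, (G + H) x ∂μ = ∫ x, G x ∂μ + ∫ x, H x ∂μ := integral_add' hGi hHi
  have h0 : ∫ x, (G + H) x ∂μ = 0 :=
    le_antisymm (by linarith) (integral_nonneg hGH)
  have hz := (integral_eq_zero_iff_of_nonneg hGH (hGi.add hHi)).1 h0
  refine ⟨G, hGm, fun x => limsup_birkhoffAverage_apply hC x, ?_, ?_⟩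
  · linarith
  · filter_upwards [hz] with x hx
    have hx' : H x = -G x := by simp only [Pi.add_apply, Pi.zero_apply] at hx; linarith
    refine Metric.tendsto_atTop'.2 fun ε hε => ?_
    obtain ⟨N, hN⟩ := eventually_atTop.1 ((hup x ε hε).and (hlow x ε hε))
    refine ⟨N, fun n hn => ?_⟩
    obtain ⟨h1, h2⟩ := hN n hn.le
    rw [Real.dist_eq, abs_lt]
    constructor <;> linarith

theorem Ergodic.ae_tendsto_birkhoffAverage [IsProbabilityMeasure μ] (hT : Ergodic T μ)
    (hgm : Measurable g) {C : ℝ} (hC : ∀ x, |g x| ≤ C) :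
    ∀ᵐ x ∂μ, Tendsto (fun n => birkhoffAverage ℝ T g n x) atTop (𝓝 (∫ x, g x ∂μ)) := by
  obtain ⟨G, hGm, hGT, hGi, hG⟩ := _root_.ae_tendsto_birkhoffAverage hT.toMeasurePreserving hgm hC
  obtain ⟨c, hc⟩ := hT.toPreErgodic.ae_eq_const_of_ae_eq_comp hGm (funext hGT)
  have hcg : ∫ x, g x ∂μ = c := by
    rw [← hGi, integral_congr_ae hc]
    simp
  filter_upwards [hG, hc] with x hx hcx
  rw [hcg]
  simpa [hcx] using hx

end Birkhoff

/-! ### Combinatorics of blocks of a bi-infinite real sequence -/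

section Blocks

theorem sum_Ico_int_consecutive (w : ℤ → ℝ) {a b c : ℤ} (hab : a ≤ b) (hbc : b ≤ c) :
    ∑ j ∈ Finset.Ico a b, w j + ∑ j ∈ Finset.Ico b c, w j = ∑ j ∈ Finset.Ico a c, w j := by
  rw [← Finset.sum_union (Finset.Ico_disjoint_Ico_consecutive a b c),
    Finset.Ico_union_Ico_eq_Ico hab hbc]

theorem sum_Ico_int_succ_top (w : ℤ → ℝ) {a b : ℤ} (hab : a ≤ b) :
    ∑ j ∈ Finset.Ico a (b + 1), w j = ∑ j ∈ Finset.Ico a b, w j + w b := by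
  rw [← sum_Ico_int_consecutive w hab (by omega : b ≤ b + 1)]
  congr 1
  rw [Finset.sum_eq_single_of_mem b (by simp)]
  intro j hj hjb
  rw [Finset.mem_Ico] at hj
  omega

/-- The interval `[a, b)` has length at least `L` and the sum of `w` over each of its initial
segments is nonnegative. -/
def IsNonnegBlock (L : ℝ) (w : ℤ → ℝ) (a b : ℤ) : Prop :=
  L ≤ (b : ℝ) - a ∧ ∀ n : ℤ, a < n → n ≤ b → 0 ≤ ∑ j ∈ Finset.Ico a n, w j

/-- The union of the blocks of `w`. -/
def nonnegBlockSet (L : ℝ) (w : ℤ → ℝ) : Set ℤ :=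
  {j | ∃ a b, IsNonnegBlock L w a b ∧ a ≤ j ∧ j < b}

variable {L : ℝ} {w : ℤ → ℝ}

/-- Peel from the right: a last time in `S` is removed together with the initial segment of its
block, which has nonnegative sum, and a last time outside `S` contributes nothing. Only a block that
starts before `0` can cost anything, and then at most `K` times remain. -/
theorem neg_le_sum_indicator_of_blocks {S : Set ℤ} {K : ℕ} {C : ℝ} (hC : ∀ j, |w j| ≤ C)
    (hS : ∀ j ∈ S, ∃ a b, IsNonnegBlock L w a b ∧ j - K ≤ a ∧ a ≤ j ∧ j < b ∧
      ∀ i, a ≤ i → i ≤ j → i ∈ S) (n : ℕ) :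
    -(K * C) ≤ ∑ j ∈ Finset.Ico (0 : ℤ) n, S.indicator w j := by
  have hC0 : 0 ≤ C := (abs_nonneg _).trans (hC 0)
  induction n using Nat.strong_induction_on with
  | _ n ih =>
    rcases Nat.eq_zero_or_pos n with rfl | hn
    · simp only [Nat.cast_zero, Finset.Ico_self, Finset.sum_empty]
      have : 0 ≤ (K : ℝ) * C := by positivity
      linarith
    by_cases hj : ((n : ℤ) - 1) ∈ S
    · obtain ⟨a, b, hab, hKa, haj, hjb, hin⟩ := hS _ hj
      by_cases ha : 0 ≤ a
      · obtain ⟨m, rfl⟩ := Int.eq_ofNat_of_zero_le ha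
        rw [← sum_Ico_int_consecutive _ (Int.natCast_nonneg m) (by omega : (m : ℤ) ≤ n)]
        have h1 := ih m (by omega)
        have h2 := hab.2 n (by omega) (by omega)
        have h3 : ∑ j ∈ Finset.Ico (m : ℤ) n, S.indicator w j = ∑ j ∈ Finset.Ico (m : ℤ) n, w j :=
          Finset.sum_congr rfl fun i hi => by
            rw [Finset.mem_Ico] at hi
            exact Set.indicator_of_mem (hin i hi.1 (by omega)) _
        linarith
      · have hnK : n ≤ K := by omega
        have h1 : |∑ j ∈ Finset.Ico (0 : ℤ) n, S.indicator w j| ≤ n * C := by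
          refine (Finset.abs_sum_le_sum_abs _ _).trans ?_
          refine (Finset.sum_le_card_nsmul _ _ C fun i _ => ?_).trans ?_
          · by_cases hi : i ∈ S
            · rw [Set.indicator_of_mem hi]; exact hC i
            · rw [Set.indicator_of_notMem hi]; simpa using hC0
          · simp
        have h2 : (n : ℝ) * C ≤ K * C := by gcongr
        linarith [(abs_le.1 h1).1]
    · obtain ⟨m, rfl⟩ : ∃ m, n = m + 1 := ⟨n - 1, by omega⟩
      have := ih m (by omega)
      push_cast at hj ⊢
      rw [sum_Ico_int_succ_top _ (Int.natCast_nonneg m),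
        Set.indicator_of_notMem (by simpa using hj)]
      linarith

/-- A block through the last time cannot reach left of `a`, so it cuts off a final piece with
nonnegative sum; recurse on what remains. -/
theorem sum_nonneg_of_subset_nonnegBlockSet {a : ℤ} (ha : a - 1 ∉ nonnegBlockSet L w) (k : ℕ)
    (hk : ∀ i, a ≤ i → i < a + k → i ∈ nonnegBlockSet L w) :
    0 ≤ ∑ j ∈ Finset.Ico a (a + k), w j := by
  induction k using Nat.strong_induction_on with
  | _ k ih =>
    rcases Nat.eq_zero_or_pos k with rfl | hk0
    · simp
    obtain ⟨c, d, hcd, hc, hd⟩ := hk (a + k - 1) (by omega) (by omega)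
    have hac : a ≤ c := by
      by_contra h
      exact ha ⟨c, d, hcd, by omega, by omega⟩
    obtain ⟨m, rfl⟩ : ∃ m : ℕ, c = a + m := ⟨(c - a).toNat, by omega⟩
    rw [← sum_Ico_int_consecutive w hac (by omega : a + (m : ℤ) ≤ a + k)]
    exact add_nonneg (ih m (by omega) fun i hi hi' => hk i hi (by omega))
      (hcd.2 _ (by omega) (by omega))

/-- Otherwise the component prolonged by one time would itself be a block: it is long enough because
it contains a block, and its shorter initial segments have nonnegative sums by the previous lemma.
-/
theorem sum_Ico_lt_of_maximal {a : ℤ} {k : ℕ} (hk : 0 < k) (ha : a - 1 ∉ nonnegBlockSet L w)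
    (hin : ∀ i, a ≤ i → i < a + k → i ∈ nonnegBlockSet L w) (hb : a + k ∉ nonnegBlockSet L w) :
    ∑ j ∈ Finset.Ico a (a + k), w j < -w (a + k) := by
  by_contra! h
  refine hb ⟨a, a + k + 1, ⟨?_, ?_⟩, by omega, by omega⟩
  · obtain ⟨c, d, hcd, hc, hd⟩ := hin (a + k - 1) (by omega) (by omega)
    have hac : a ≤ c := by
      by_contra h
      exact ha ⟨c, d, hcd, by omega, by omega⟩
    have hdb : d ≤ a + k := by
      by_contra h
      exact hb ⟨c, d, hcd, by omega, by omega⟩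
    have h1 : (a : ℝ) ≤ c := by exact_mod_cast hac
    have h2 : (d : ℝ) ≤ a + k := by exact_mod_cast hdb
    have := hcd.1
    push_cast
    linarith
  · intro n hn hn'
    rcases hn'.lt_or_eq with hlt | rfl
    · obtain ⟨m, rfl⟩ : ∃ m : ℕ, n = a + m := ⟨(n - a).toNat, by omega⟩
      exact sum_nonneg_of_subset_nonnegBlockSet ha m fun i hi hi' => hin i hi (by omega)
    · rw [sum_Ico_int_succ_top w (by omega)]
      linarith

/-- With `w = α - φ` the summand is φ on the covered times, plus `C` at the last time of each
component. By maximality the sum of φ over a component exceeds `w` at the next time, which is at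
least `-C`; the bonus compensates for that. -/
theorem sum_indicator_add_ends_nonneg {α C : ℝ} (hα : 0 ≤ α) (hC : ∀ j, |α - w j| ≤ C)
    (h0 : (0 : ℤ) ∉ nonnegBlockSet L w) (n : ℕ) (hn : (n : ℤ) ∉ nonnegBlockSet L w) :
    0 ≤ ∑ j ∈ Finset.Ico (0 : ℤ) n, ((nonnegBlockSet L w).indicator (fun j => α - w j) j +
      {j | j ∈ nonnegBlockSet L w ∧ j + 1 ∉ nonnegBlockSet L w}.indicator (fun _ => C) j) := by
  set S := nonnegBlockSet L w with hS
  set D := {j | j ∈ S ∧ j + 1 ∉ S} with hD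
  set t : ℤ → ℝ := fun j => S.indicator (fun j => α - w j) j + D.indicator (fun _ => C) j with ht
  change 0 ≤ ∑ j ∈ Finset.Ico (0 : ℤ) n, t j
  have hC0 : 0 ≤ C := (abs_nonneg _).trans (hC 0)
  have htS : ∀ j ∉ S, t j = 0 := fun j hj => by
    simp only [t]
    rw [Set.indicator_of_notMem hj, Set.indicator_of_notMem fun h => hj h.1, add_zero]
  induction n using Nat.strong_induction_on with
  | _ n ih =>
    rcases Nat.eq_zero_or_pos n with rfl | hn0
    · simp
    -- Between the last uncovered time `c` before `n` and `n` itself there is either nothing or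
    -- exactly one whole component.
    obtain ⟨c, ⟨hcS, hcn⟩, hmax⟩ := Int.exists_greatest_of_bdd (P := fun z => z ∉ S ∧ z < n)
      ⟨n, fun z hz => hz.2.le⟩ ⟨0, h0, by omega⟩
    have hc0 : 0 ≤ c := hmax 0 ⟨h0, by omega⟩
    obtain ⟨m, rfl⟩ := Int.eq_ofNat_of_zero_le hc0
    have hm := ih m (by omega) hcS
    have hin : ∀ i : ℤ, m < i → i < n → i ∈ S := fun i hi hi' => by
      by_contra h
      have := hmax i ⟨h, hi'⟩
      omega
    rw [← sum_Ico_int_consecutive t (by omega : (0 : ℤ) ≤ m + 1) (by omega : (m : ℤ) + 1 ≤ n),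
      sum_Ico_int_succ_top t hc0, htS _ hcS, add_zero]
    refine add_nonneg hm ?_
    rcases Nat.lt_or_ge (m + 1) n with hlt | hge
    · obtain ⟨k, rfl⟩ : ∃ k, n = m + 1 + (k + 1) := ⟨n - m - 2, by omega⟩
      have hlast := sum_Ico_lt_of_maximal (L := L) (w := w) (a := m + 1) (k := k + 1) (by omega)
        (by simpa using hcS) (fun i hi hi' => hin i (by omega) (by push_cast at hi' ⊢; omega))
        (by exact_mod_cast hn)
      set e : ℤ := (m : ℤ) + 1 + k with he
      have hcast : (((m + 1 + (k + 1) : ℕ)) : ℤ) = e + 1 := by push_cast; omega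
      have hcast' : (m : ℤ) + 1 + ((k + 1 : ℕ) : ℤ) = e + 1 := by push_cast; omega
      rw [hcast] at hn hin
      rw [hcast'] at hlast
      rw [hcast]
      have h1 : ∀ j ∈ Finset.Ico ((m : ℤ) + 1) (e + 1), S.indicator (fun j => α - w j) j
          = α - w j := fun j hj => by
        rw [Finset.mem_Ico] at hj
        exact Set.indicator_of_mem (hin j (by omega) hj.2) _
      have h2 : C ≤ ∑ j ∈ Finset.Ico ((m : ℤ) + 1) (e + 1), D.indicator (fun _ => C) j := by
        have heD : e ∈ D := ⟨hin e (by omega) (by omega), hn⟩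
        calc C = D.indicator (fun _ => C) e := (Set.indicator_of_mem heD fun _ => C).symm
          _ ≤ _ := Finset.single_le_sum (f := fun j => D.indicator (fun _ => C) j)
            (fun j _ => Set.indicator_nonneg (fun _ _ => hC0) j)
            (Finset.mem_Ico.2 ⟨by omega, by omega⟩)
      simp only [t]
      rw [Finset.sum_add_distrib, Finset.sum_congr rfl h1, Finset.sum_sub_distrib,
        Finset.sum_const, nsmul_eq_mul]
      have h3 : 0 ≤ ((Finset.Ico ((m : ℤ) + 1) (e + 1)).card : ℝ) * α := by positivity
      have h4 := (abs_le.1 (hC (e + 1))).2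
      linarith
    · rw [Finset.Ico_eq_empty (by omega), Finset.sum_empty]

/-- A block covering `i + 1` must start there and must end by `j`, and its length is at least `L`.
-/
theorem add_le_of_notMem_nonnegBlockSet {i j : ℤ} (hij : i < j) (hi : i ∉ nonnegBlockSet L w)
    (hi' : i + 1 ∈ nonnegBlockSet L w) (hj : j ∉ nonnegBlockSet L w) : (i : ℝ) + 1 + L ≤ j := by
  obtain ⟨a, b, hab, ha, hb⟩ := hi'
  have hai : a = i + 1 := by
    by_contra h
    exact hi ⟨a, b, hab, by omega, by omega⟩
  have hbj : b ≤ j := by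
    by_contra h
    exact hj ⟨a, b, hab, by omega, by omega⟩
  have h1 : (b : ℝ) ≤ j := by exact_mod_cast hbj
  have h2 : (a : ℝ) = i + 1 := by exact_mod_cast hai
  have := hab.1
  linarith

end Blocks

/-! ### Neutral times as visits to a measurable set -/

section NeutralLocus

variable {X : Type*} [TopologicalSpace X] {α L : ℝ} {f : X ≃ₜ X} {φ : X → ℝ} {x : X}

/-- The set of points for which the time `0` belongs to a neutral block. -/
def neutralLocus (α L : ℝ) (f : X ≃ₜ X) (φ : X → ℝ) : Set X :=
  {x | (0 : ℤ) ∈ neutralSet α L x f φ}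

theorem isNeutralBlock_iff {a b : ℤ} : IsNeutralBlock α L x f φ a b ↔
    IsNonnegBlock L (fun j => α - φ ((f ^ j) x)) a b := by
  refine and_congr Iff.rfl (forall_congr' fun n => forall_congr' fun hn => imp_congr_right fun _ => ?_)
  rw [Finset.sum_sub_distrib, Finset.sum_const, Int.card_Ico, nsmul_eq_mul, sub_nonneg, mul_comm]
  have : (((n - a).toNat : ℕ) : ℝ) = n - a := by
    have : (((n - a).toNat : ℕ) : ℤ) = n - a := by omega
    exact_mod_cast this
  rw [this]

theorem neutralSet_eq : neutralSet α L x f φ = nonnegBlockSet L fun j => α - φ ((f ^ j) x) := by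
  ext j
  simp only [neutralSet, nonnegBlockSet, isNeutralBlock_iff]

theorem sum_zpow_apply_zpow (f : X ≃ₜ X) (φ : X → ℝ) (x : X) (a n j : ℤ) :
    ∑ i ∈ Finset.Ico a n, φ ((f ^ i) ((f ^ j) x)) =
      ∑ i ∈ Finset.Ico (a + j) (n + j), φ ((f ^ i) x) := by
  rw [← Finset.sum_Ico_add']
  refine Finset.sum_congr rfl fun i _ => ?_
  rw [zpow_add]; rfl

theorem isNeutralBlock_zpow_apply {a b j : ℤ} : IsNeutralBlock α L ((f ^ j) x) f φ a b ↔
    IsNeutralBlock α L x f φ (a + j) (b + j) := by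
  constructor
  · rintro ⟨h1, h2⟩
    refine ⟨by push_cast; linarith, fun n hn hn' => ?_⟩
    have := h2 (n - j) (by omega) (by omega)
    rw [sum_zpow_apply_zpow, sub_add_cancel] at this
    push_cast at this ⊢
    linarith
  · rintro ⟨h1, h2⟩
    refine ⟨by push_cast at h1; linarith, fun n hn hn' => ?_⟩
    have := h2 (n + j) (by omega) (by omega)
    rw [← sum_zpow_apply_zpow] at this
    push_cast at this ⊢
    linarith

/-- Neutral blocks shift along the orbit. This turns statements about times into statements about
one set, to which invariance and the ergodic theorem apply. -/
theorem zpow_apply_mem_neutralLocus_iff {j : ℤ} :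
    (f ^ j) x ∈ neutralLocus α L f φ ↔ j ∈ neutralSet α L x f φ := by
  simp only [neutralLocus, neutralSet, Set.mem_ofPred_eq, isNeutralBlock_zpow_apply]
  constructor
  · rintro ⟨a, b, h, ha, hb⟩
    exact ⟨a + j, b + j, h, by omega, by omega⟩
  · rintro ⟨a, b, h, ha, hb⟩
    exact ⟨a - j, b - j, by simpa using h, by omega, by omega⟩

theorem zpow_natCast_apply (f : X ≃ₜ X) (n : ℕ) (x : X) : (f ^ (n : ℤ)) x = f^[n] x := by
  rw [zpow_natCast]
  induction n generalizing x with
  | zero => rfl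
  | succ n ih => rw [pow_succ, Function.iterate_succ_apply, ← ih]; rfl

theorem mem_neutralTimes_iff {n : ℕ} :
    n ∈ neutralTimes α L x f φ ↔ f^[n] x ∈ neutralLocus α L f φ := by
  rw [← zpow_natCast_apply, zpow_apply_mem_neutralLocus_iff]; rfl

theorem neutralLocus_mono {α' L' : ℝ} (hα : α' ≤ α) (hL : L ≤ L') :
    neutralLocus α' L' f φ ⊆ neutralLocus α L f φ := by
  rintro x ⟨a, b, ⟨h1, h2⟩, ha, hb⟩
  refine ⟨a, b, ⟨hL.trans h1, fun n hn hn' => (h2 n hn hn').trans ?_⟩, ha, hb⟩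
  have : (a : ℝ) < n := by exact_mod_cast hn
  gcongr

theorem birkhoffSum_eq_sum_zpow (f : X ≃ₜ X) (g : X → ℝ) (n : ℕ) (x : X) :
    birkhoffSum f g n x = ∑ j ∈ Finset.Ico (0 : ℤ) n, g ((f ^ j) x) := by
  induction n with
  | zero => simp
  | succ n ih =>
    rw [birkhoffSum_succ, ih, Nat.cast_succ, sum_Ico_int_succ_top _ (Int.natCast_nonneg n),
      zpow_natCast_apply]

theorem measurableSet_isNeutralBlock [MeasurableSpace X] [BorelSpace X] (hφ : Continuous φ)
    (a b : ℤ) : MeasurableSet {x | IsNeutralBlock α L x f φ a b} := by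
  simp only [IsNeutralBlock, Set.ofPred_and, Set.ofPred_forall]
  refine (MeasurableSet.const _).inter (MeasurableSet.iInter fun n => MeasurableSet.iInter fun _ =>
    MeasurableSet.iInter fun _ => ?_)
  refine (isClosed_le ?_ continuous_const).measurableSet
  exact continuous_finsetSum _ fun j _ => hφ.comp (f ^ j).continuous

theorem measurableSet_exists_isNeutralBlock [MeasurableSpace X] [BorelSpace X] (hφ : Continuous φ)
    (P : ℤ → ℤ → Prop) : MeasurableSet {x | ∃ a b, IsNeutralBlock α L x f φ a b ∧ P a b} := by
  simp only [Set.ofPred_exists, Set.ofPred_and]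
  exact MeasurableSet.iUnion fun a => MeasurableSet.iUnion fun b =>
    (measurableSet_isNeutralBlock hφ a b).inter (MeasurableSet.const _)

theorem measurableSet_neutralLocus [MeasurableSpace X] [BorelSpace X] (hφ : Continuous φ) :
    MeasurableSet (neutralLocus α L f φ) :=
  measurableSet_exists_isNeutralBlock hφ fun a b => a ≤ 0 ∧ 0 < b

end NeutralLocus

/-! ### Integrals over the neutral locus and the measure of its boundary -/

section Estimates

/-- Leaving `N` is as frequent as entering it: two sets of equal measure lose the same intersection.
-/
theorem measureReal_diff_preimage_eq {X : Type*} [MeasurableSpace X] {f : X → X} {ν : Measure X}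
    [IsFiniteMeasure ν] (hf : MeasurePreserving f ν ν) {N : Set X}
    (hN : MeasurableSet N) : ν.real (N \ f ⁻¹' N) = ν.real (f ⁻¹' N \ N) := by
  have h1 := measureReal_inter_add_sdiff (μ := ν) (s := N) (hf.measurable hN)
  have h2 := measureReal_inter_add_sdiff (μ := ν) (s := f ⁻¹' N) hN
  have h3 : ν.real (f ⁻¹' N) = ν.real N := hf.measureReal_preimage hN.nullMeasurableSet
  rw [Set.inter_comm] at h2
  linarith

variable {X : Type*} [TopologicalSpace X] [MeasurableSpace X] [BorelSpace X] {α L : ℝ}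
  {f : X ≃ₜ X} {φ : X → ℝ} {ν : Measure X}

/-- Requiring the block to start at most `K` steps in the past bounds the loss at the left end of an
orbit segment by `K * C`, independently of its length; the loss disappears in the Birkhoff average.
-/
theorem setIntegral_truncated_neutralLocus_nonneg [IsFiniteMeasure ν]
    (hf : MeasurePreserving f ν ν) (hφ : Continuous φ) {C : ℝ} (hC : ∀ x, |α - φ x| ≤ C) (K : ℕ) :
    0 ≤ ∫ x in {x | ∃ a b, IsNeutralBlock α L x f φ a b ∧ (-(K : ℤ) ≤ a ∧ a ≤ 0 ∧ 0 < b)},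
      (α - φ x) ∂ν := by
  set N := {x | ∃ a b, IsNeutralBlock α L x f φ a b ∧ (-(K : ℤ) ≤ a ∧ a ≤ 0 ∧ 0 < b)} with hN
  have hNm : MeasurableSet N := measurableSet_exists_isNeutralBlock hφ _
  have hgm : Measurable (N.indicator fun x => α - φ x) :=
    (measurable_const.sub hφ.measurable).indicator hNm
  have hgC : ∀ x, |N.indicator (fun x => α - φ x) x| ≤ C := fun x => by
    by_cases hx : x ∈ N
    · rw [Set.indicator_of_mem hx]; exact hC x
    · rw [Set.indicator_of_notMem hx, abs_zero]; exact (abs_nonneg _).trans (hC x)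
  obtain ⟨G, -, -, hGi, hG⟩ := ae_tendsto_birkhoffAverage hf hgm hgC
  rw [← integral_indicator hNm, ← hGi]
  refine integral_nonneg_of_ae ?_
  filter_upwards [hG] with x hx
  have hlow : ∀ n : ℕ, -(K * C) * (n : ℝ)⁻¹ ≤
      birkhoffAverage ℝ f (N.indicator fun x => α - φ x) n x := by
    intro n
    rw [birkhoffAverage, smul_eq_mul, mul_comm]
    refine mul_le_mul_of_nonneg_left ?_ (by positivity)
    rw [birkhoffSum_eq_sum_zpow]
    refine neg_le_sum_indicator_of_blocks (L := L) (w := fun j => α - φ ((f ^ j) x))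
      (S := {j | (f ^ j) x ∈ N}) (fun j => hC _) ?_ n
    rintro j ⟨a, b, hab, hKa, ha, hb⟩
    rw [isNeutralBlock_zpow_apply] at hab
    -- Earlier times of the block are in the truncated set by the same block, whose start is even
    -- closer to them.
    refine ⟨a + j, b + j, isNeutralBlock_iff.1 hab, by omega, by omega, by omega,
      fun i hi hij => ⟨a + j - i, b + j - i, ?_, by omega, by omega, by omega⟩⟩
    rw [isNeutralBlock_zpow_apply]
    simpa using hab
  refine le_of_tendsto_of_tendsto' ?_ hx hlow
  simpa using (tendsto_inv_atTop_nhds_zero_nat (𝕜 := ℝ)).const_mul (-(K * C))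

theorem setIntegral_neutralLocus_le [IsProbabilityMeasure ν] (hf : MeasurePreserving f ν ν)
    (hφ : Continuous φ) {C : ℝ} (hC : ∀ x, |φ x| ≤ C) (hα : 0 ≤ α) :
    ∫ x in neutralLocus α L f φ, φ x ∂ν ≤ α := by
  have hC' : ∀ x, |α - φ x| ≤ α + C := fun x => by
    have := abs_le.1 (hC x)
    exact abs_le.2 ⟨by linarith, by linarith⟩
  have hφi : Integrable φ ν := integrable_of_abs_le hφ.measurable hC
  set N : ℕ → Set X := fun K =>
    {x | ∃ a b, IsNeutralBlock α L x f φ a b ∧ (-(K : ℤ) ≤ a ∧ a ≤ 0 ∧ 0 < b)} with hN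
  have hmono : Monotone N := by
    rintro K K' hK x ⟨a, b, h, ha, h'⟩
    exact ⟨a, b, h, by omega, h'⟩
  have hU : ⋃ K, N K = neutralLocus α L f φ := by
    ext x
    rw [Set.mem_iUnion]
    constructor
    · rintro ⟨K, a, b, h, -, h'⟩
      exact ⟨a, b, h, h'⟩
    · rintro ⟨a, b, h, h'⟩
      exact ⟨a.natAbs, a, b, h, by omega, h'⟩
  have hlim := tendsto_setIntegral_of_monotone (μ := ν) (f := fun x => α - φ x) (s := N)
    (fun K => measurableSet_exists_isNeutralBlock hφ _) hmono
    ((integrable_const α).sub hφi).integrableOn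
  have h0 : 0 ≤ ∫ x in neutralLocus α L f φ, (α - φ x) ∂ν := by
    rw [← hU]
    exact ge_of_tendsto' hlim fun K => setIntegral_truncated_neutralLocus_nonneg hf hφ hC' K
  rw [integral_sub (integrable_const α) hφi.integrableOn, setIntegral_const, smul_eq_mul] at h0
  have : ν.real (neutralLocus α L f φ) * α ≤ 1 * α := by gcongr; exact measureReal_le_one
  linarith

/-- After entering, an orbit stays inside for at least `L` steps, so the entrance events at `l ≤ L`
consecutive times are disjoint; by invariance they have equal measure. -/
theorem natCast_mul_measureReal_preimage_diff_le [IsProbabilityMeasure ν]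
    (hf : MeasurePreserving f ν ν) (hφ : Continuous φ) {l : ℕ} (hl : (l : ℝ) ≤ L) :
    l * ν.real (f ⁻¹' neutralLocus α L f φ \ neutralLocus α L f φ) ≤ 1 := by
  set N := neutralLocus α L f φ with hN
  have hNm : MeasurableSet N := measurableSet_neutralLocus hφ
  set A := f ⁻¹' N \ N with hA
  have hAm : MeasurableSet A := (hf.measurable hNm).diff hNm
  have key : ∀ i j : ℕ, i < j → j < l → Disjoint (f^[i] ⁻¹' A) (f^[j] ⁻¹' A) := by
    intro i j hij hj
    rw [Set.disjoint_left]
    rintro x ⟨hi', hi⟩ ⟨-, hj'⟩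
    rw [Set.mem_preimage, ← Function.iterate_succ_apply' f i x] at hi'
    rw [← zpow_natCast_apply, zpow_apply_mem_neutralLocus_iff, neutralSet_eq] at hi hj' hi'
    have := add_le_of_notMem_nonnegBlockSet (by exact_mod_cast hij) hi (by exact_mod_cast hi') hj'
    have h1 : (j : ℝ) < l := by exact_mod_cast hj
    have h2 : (0 : ℝ) ≤ i := Nat.cast_nonneg i
    push_cast at this
    linarith
  have hdis : (Finset.range l : Set ℕ).PairwiseDisjoint fun j => f^[j] ⁻¹' A := by
    intro i hi j hj hij
    simp only [Finset.coe_range, Set.mem_Iio] at hi hj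
    rcases lt_or_gt_of_ne hij with h | h
    · exact key i j h hj
    · exact (key j i h hi).symm
  have hsum := measureReal_biUnion_finset (μ := ν) hdis fun j _ => (hf.measurable.iterate j) hAm
  have heq : ∀ j ∈ Finset.range l, ν.real (f^[j] ⁻¹' A) = ν.real A := fun j _ =>
    (hf.iterate j).measureReal_preimage hAm.nullMeasurableSet
  rw [Finset.sum_congr rfl heq, Finset.sum_const, Finset.card_range, nsmul_eq_mul] at hsum
  rw [← hsum]
  exact measureReal_le_one

theorem neg_le_setIntegral_neutralLocus [IsProbabilityMeasure ν] (hf : Ergodic f ν)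
    (hφ : Continuous φ) {C : ℝ} (hC : ∀ x, |φ x| ≤ C) (hα : 0 ≤ α) (hint : 0 ≤ ∫ x, φ x ∂ν) :
    -(C * ν.real (neutralLocus α L f φ \ f ⁻¹' neutralLocus α L f φ)) ≤
      ∫ x in neutralLocus α L f φ, φ x ∂ν := by
  set N := neutralLocus α L f φ with hN
  have hNm : MeasurableSet N := measurableSet_neutralLocus hφ
  set D := N \ f ⁻¹' N with hD
  have hDm : MeasurableSet D := hNm.diff (hf.measurable hNm)
  obtain ⟨x₀⟩ : Nonempty X := nonempty_of_isProbabilityMeasure ν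
  have hC0 : 0 ≤ C := (abs_nonneg _).trans (hC x₀)
  -- If almost every time is neutral, no component needs to end, and only the sign of the full
  -- integral gives the bound.
  by_cases hNc : ν Nᶜ = 0
  · rw [setIntegral_eq_integral_of_ae_compl_eq_zero]
    · have : 0 ≤ C * ν.real D := by positivity
      linarith
    · have : ∀ᵐ x ∂ν, x ∈ N := hNc
      filter_upwards [this] with x hx hx'
      exact absurd hx hx'
  set g : X → ℝ := fun x => N.indicator φ x + D.indicator (fun _ => C) x with hg
  have hgm : Measurable g := (hφ.measurable.indicator hNm).add (measurable_const.indicator hDm)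
  have hgC : ∀ x, |g x| ≤ C + C := fun x => by
    refine (abs_add_le _ _).trans (add_le_add ?_ ?_)
    · by_cases hx : x ∈ N
      · rw [Set.indicator_of_mem hx]; exact hC x
      · rw [Set.indicator_of_notMem hx, abs_zero]; exact hC0
    · by_cases hx : x ∈ D
      · rw [Set.indicator_of_mem hx, abs_of_nonneg hC0]
      · rw [Set.indicator_of_notMem hx, abs_zero]; exact hC0
  -- A typical point outside `N` returns there infinitely often. At the return times all components
  -- met are complete, so the sums of `g` are nonnegative; ergodicity carries the sign at this
  -- single point over to the integral.
  have hrec := hf.toMeasurePreserving.conservative.ae_mem_imp_frequently_image_mem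
    hNm.compl.nullMeasurableSet
  have hb := hf.ae_tendsto_birkhoffAverage hgm hgC
  have hfr : ∃ᵐ x ∂ν, x ∈ Nᶜ := frequently_ae_mem_iff.2 hNc
  obtain ⟨x, hxN, hxr, hxb⟩ := (hfr.and_eventually (hrec.and hb)).exists
  have h0 : 0 ≤ ∫ x, g x ∂ν := by
    refine ge_of_tendsto_of_frequently hxb ((hxr hxN).mono fun n hn => ?_)
    rw [birkhoffAverage, smul_eq_mul]
    refine mul_nonneg (by positivity) ?_
    rw [birkhoffSum_eq_sum_zpow]
    have hS : ∀ j : ℤ, j ∈ nonnegBlockSet L (fun j => α - φ ((f ^ j) x)) ↔ (f ^ j) x ∈ N :=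
      fun j => by rw [← neutralSet_eq, ← zpow_apply_mem_neutralLocus_iff]
    have hx0 : (0 : ℤ) ∉ nonnegBlockSet L (fun j => α - φ ((f ^ j) x)) := by
      rw [hS]; exact hxN
    have hxn : (n : ℤ) ∉ nonnegBlockSet L (fun j => α - φ ((f ^ j) x)) := by
      rw [hS, zpow_natCast_apply]; exact hn
    refine (sum_indicator_add_ends_nonneg hα (C := C) (fun j => by simpa using hC _) hx0 n
      hxn).trans_eq (Finset.sum_congr rfl fun j _ => ?_)
    simp only [g]
    have hsucc : f ((f ^ j) x) = (f ^ (j + 1)) x := by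
      rw [add_comm, zpow_add, zpow_one]; rfl
    congr 1
    · by_cases hj : (f ^ j) x ∈ N
      · rw [Set.indicator_of_mem hj, Set.indicator_of_mem ((hS j).2 hj)]; ring
      · rw [Set.indicator_of_notMem hj, Set.indicator_of_notMem fun h => hj ((hS j).1 h)]
    · by_cases hj : (f ^ j) x ∈ D
      · rw [Set.indicator_of_mem hj, Set.indicator_of_mem]
        refine ⟨(hS j).2 hj.1, fun h => hj.2 ?_⟩
        rw [Set.mem_preimage, hsucc]
        exact (hS _).1 h
      · rw [Set.indicator_of_notMem hj, Set.indicator_of_notMem]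
        rintro ⟨h1, h2⟩
        refine hj ⟨(hS j).1 h1, fun h => h2 ((hS _).2 ?_)⟩
        rw [Set.mem_preimage, hsucc] at h
        exact h
  have hgi : ∫ x, g x ∂ν = ∫ x in N, φ x ∂ν + C * ν.real D := by
    rw [integral_add ((integrable_of_abs_le hφ.measurable hC).indicator hNm)
      ((integrable_const C).indicator hDm), integral_indicator hNm, integral_indicator hDm,
      setIntegral_const, smul_eq_mul, mul_comm C]
  linarith

/-- By invariance the second integral is that of `h ∘ f` over the preimage of `N`, so the two differ
only on the symmetric difference, whose halves have equal measure. -/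
theorem abs_setIntegral_comp_sub_le [IsFiniteMeasure ν] (hf : MeasurePreserving f ν ν)
    {N : Set X} (hN : MeasurableSet N) {h : X → ℝ} (hh : Measurable h) {C : ℝ}
    (hC : ∀ x, |h x| ≤ C) :
    |∫ x in N, h (f x) ∂ν - ∫ x in N, h x ∂ν| ≤ 2 * C * ν.real (f ⁻¹' N \ N) := by
  have h1 : ∫ x in N, h x ∂ν = ∫ x in f ⁻¹' N, h (f x) ∂ν :=
    (hf.setIntegral_preimage_emb f.measurableEmbedding h N).symm
  have hi : Integrable (fun x => h (f x)) ν :=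
    integrable_of_abs_le (hh.comp hf.measurable) fun x => hC _
  have h2 := integral_inter_add_sdiff (μ := ν) (s := N) (hf.measurable hN) hi.integrableOn
  have h3 := integral_inter_add_sdiff (μ := ν) (s := f ⁻¹' N) hN hi.integrableOn
  rw [Set.inter_comm] at h3
  have hb : ∀ s : Set X, |∫ x in s, h (f x) ∂ν| ≤ C * ν.real s := fun s => by
    rw [← Real.norm_eq_abs]
    exact norm_setIntegral_le_of_norm_le_const (measure_lt_top _ _) fun x _ => hC (f x)
  have h4 := abs_le.1 (hb (N \ f ⁻¹' N))
  have h5 := abs_le.1 (hb (f ⁻¹' N \ N))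
  rw [measureReal_diff_preimage_eq hf hN] at h4
  rw [h1, abs_le]
  constructor <;> linarith

end Estimates

/-! ### Empirical measures of typical points -/

section Empirical

variable {X : Type*} [MetricSpace X] [CompactSpace X] [MeasurableSpace X] [BorelSpace X]

theorem integral_partialEmpirical (f : X ≃ₜ X) (S : Set X) (x : X) (n : ℕ)
    (h : BoundedContinuousFunction X ℝ) :
    ∫ y, h y ∂(partialEmpirical f {j | f^[j] x ∈ S} x n : Measure X) =
      birkhoffAverage ℝ f (S.indicator h) n x := by
  classical
  rw [partialEmpirical, FiniteMeasure.toMeasure_smul, integral_smul_nnreal_measure,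
    FiniteMeasure.toMeasure_sum, integral_finsetSum_measure fun j _ => h.integrable _]
  rw [birkhoffAverage, birkhoffSum, NNReal.smul_def, Finset.sum_filter]
  push_cast
  congr 1
  refine Finset.sum_congr rfl fun j _ => ?_
  by_cases hj : f^[j] x ∈ S
  · rw [if_pos (by exact hj), Set.indicator_of_mem hj]
    exact integral_dirac _ _
  · rw [if_neg (by exact hj), Set.indicator_of_notMem hj]

theorem abs_setIntegral_sub_le {X : Type*} [MeasurableSpace X] {ν : Measure X}
    [IsProbabilityMeasure ν] (S : Set X) {h h' : X → ℝ}
    (hh : Integrable h ν) (hh' : Integrable h' ν) {δ : ℝ} (hδ : ∀ x, |h x - h' x| ≤ δ) :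
    |∫ x in S, h x ∂ν - ∫ x in S, h' x ∂ν| ≤ δ := by
  obtain ⟨x₀⟩ : Nonempty X := nonempty_of_isProbabilityMeasure ν
  have hδ0 : 0 ≤ δ := (abs_nonneg _).trans (hδ x₀)
  rw [← integral_sub hh.integrableOn hh'.integrableOn, ← Real.norm_eq_abs]
  refine (norm_setIntegral_le_of_norm_le_const (measure_lt_top _ _) fun x _ => hδ x).trans ?_
  exact mul_le_of_le_one_right hδ0 measureReal_le_one

/-- The restriction of a probability measure to a set, as a finite measure. -/
noncomputable def restrictFinite {X : Type*} [MeasurableSpace X] (ν : ProbabilityMeasure X)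
    (S : Set X) : FiniteMeasure X :=
  ⟨(ν : Measure X).restrict S, inferInstance⟩

/-- The ergodic theorem for a countable dense family in C(X, ℝ) leaves one null set; uniform
approximation handles all other test functions. -/
theorem ae_tendsto_partialEmpirical {f : X ≃ₜ X} {ν : ProbabilityMeasure X}
    (hf : Ergodic f (ν : Measure X)) {S : Set X} (hS : MeasurableSet S) :
    ∀ᵐ x ∂(ν : Measure X), Tendsto (partialEmpirical f {j | f^[j] x ∈ S} x) atTop
      (𝓝 (restrictFinite ν S)) := by
  have hind : ∀ (h : X → ℝ) (C : ℝ), 0 ≤ C → (∀ x, |h x| ≤ C) → ∀ x, |S.indicator h x| ≤ C := by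
    intro h C hC0 hC x
    by_cases hx : x ∈ S
    · rw [Set.indicator_of_mem hx]; exact hC x
    · rw [Set.indicator_of_notMem hx, abs_zero]; exact hC0
  have hb : ∀ d : ℕ, ∀ᵐ x ∂(ν : Measure X), Tendsto (fun n => birkhoffAverage ℝ f
      (S.indicator (TopologicalSpace.denseSeq C(X, ℝ) d)) n x) atTop
      (𝓝 (∫ y in S, TopologicalSpace.denseSeq C(X, ℝ) d y ∂(ν : Measure X))) := by
    intro d
    rw [← integral_indicator hS]
    exact hf.ae_tendsto_birkhoffAverage
      ((TopologicalSpace.denseSeq C(X, ℝ) d).continuous.measurable.indicator hS)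
      (hind _ _ (norm_nonneg _) fun x => (TopologicalSpace.denseSeq C(X, ℝ) d).norm_coe_le_norm x)
  filter_upwards [ae_all_iff.2 hb] with x hx
  refine FiniteMeasure.tendsto_of_forall_integral_tendsto fun h => ?_
  simp only [integral_partialEmpirical]
  change Tendsto _ _ (𝓝 (∫ y in S, h y ∂(ν : Measure X)))
  refine Metric.tendsto_atTop'.2 fun ε hε => ?_
  obtain ⟨d, hd⟩ := (TopologicalSpace.denseRange_denseSeq C(X, ℝ)).exists_dist_lt
    h.toContinuousMap (by linarith : 0 < ε / 3)
  set k := TopologicalSpace.denseSeq C(X, ℝ) d with hk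
  have hhk : ∀ y, |h y - k y| ≤ ε / 3 := fun y =>
    (ContinuousMap.dist_apply_le_dist (f := h.toContinuousMap) (g := k) y).trans hd.le
  obtain ⟨N, hN⟩ := Metric.tendsto_atTop'.1 (hx d) (ε / 3) (by linarith)
  refine ⟨N, fun n hn => ?_⟩
  have h1 := hN n hn
  have h2 : |birkhoffAverage ℝ f (S.indicator (⇑h - ⇑k)) n x| ≤ ε / 3 :=
    abs_birkhoffAverage_le (hind _ _ (by linarith) hhk) n x
  rw [Set.indicator_sub', birkhoffAverage_sub, Pi.sub_apply, Pi.sub_apply] at h2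
  have h3 := abs_setIntegral_sub_le S (h.integrable (ν : Measure X))
    (integrable_of_abs_le (μ := (ν : Measure X)) k.continuous.measurable k.norm_coe_le_norm) hhk
  rw [Real.dist_eq] at h1 ⊢
  rw [abs_lt] at h1 ⊢
  rw [abs_le] at h2 h3
  constructor <;> linarith

theorem empiricalMeasures_subset {X : Type*} [MetricSpace X] [MeasurableSpace X] [BorelSpace X]
    {f : X ≃ₜ X} {N : Set ℕ} {x : X} {m : FiniteMeasure X}
    (h : Tendsto (partialEmpirical f N x) atTop (𝓝 m)) : empiricalMeasures f N x ⊆ {m} := by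
  intro m' hm'
  have : (𝓝 m' ⊓ 𝓝 m).NeBot := NeBot.mono hm' (inf_le_inf_left _ h)
  exact eq_of_nhds_neBot this

theorem ae_empiricalMeasures_subset {f : X ≃ₜ X} {φ : X → ℝ} (hφ : Continuous φ)
    {ν : ProbabilityMeasure X} (hf : Ergodic f (ν : Measure X)) (α L : ℝ) :
    ∀ᵐ x ∂(ν : Measure X),
      empiricalMeasures f (neutralTimes α L x f φ) x ⊆
        {restrictFinite ν (neutralLocus α L f φ)} ∧
      empiricalMeasures f (neutralTimes α L x f φ)ᶜ x ⊆
        {restrictFinite ν (neutralLocus α L f φ)ᶜ} := by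
  have hN : MeasurableSet (neutralLocus α L f φ) := measurableSet_neutralLocus hφ
  filter_upwards [ae_tendsto_partialEmpirical hf hN, ae_tendsto_partialEmpirical hf hN.compl]
    with x h1 h2
  have heq : neutralTimes α L x f φ = {j | f^[j] x ∈ neutralLocus α L f φ} :=
    Set.ext fun n => mem_neutralTimes_iff
  rw [heq]
  exact ⟨empiricalMeasures_subset h1, empiricalMeasures_subset h2⟩

end Empirical

/-! ### Simultaneous weak limits of restrictions, by coding -/

section Coding

open Classical in
/-- The itinerary of a point with respect to a sequence of sets. -/
noncomputable def codingMap {X : Type*} (N : ℕ → Set X) (x : X) : X × (ℕ → Bool) :=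
  (x, fun p => decide (x ∈ N p))

theorem codingMap_snd {X : Type*} (N : ℕ → Set X) (x : X) (p : ℕ) :
    (codingMap N x).2 p = true ↔ x ∈ N p := by
  simp [codingMap]

theorem measurable_codingMap {X : Type*} [MeasurableSpace X] {N : ℕ → Set X}
    (hN : ∀ p, MeasurableSet (N p)) : Measurable (codingMap N) := by
  refine measurable_id.prodMk (measurable_pi_iff.2 fun p => measurable_to_bool ?_)
  convert hN p using 1
  ext x
  simp

theorem measure_eq_zero_of_tendsto {Y : Type*} [TopologicalSpace Y] [MeasurableSpace Y]
    [OpensMeasurableSpace Y] [HasOuterApproxClosed Y] {ρ : ProbabilityMeasure Y}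
    {ρs : ℕ → ProbabilityMeasure Y} (h : Tendsto ρs atTop (𝓝 ρ)) {G : Set Y} (hG : IsOpen G)
    (h0 : ∀ᶠ i in atTop, (ρs i : Measure Y) G = 0) : (ρ : Measure Y) G = 0 := by
  have h1 := ProbabilityMeasure.le_liminf_measure_open_of_tendsto h hG
  have h2 : Tendsto (fun i => (ρs i : Measure Y) G) atTop (𝓝 0) :=
    tendsto_const_nhds.congr' (h0.mono fun i hi => hi.symm)
  rw [h2.liminf_eq] at h1
  exact le_antisymm h1 bot_le

variable {X : Type*} [MetricSpace X] [CompactSpace X]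

/-- A bounded continuous function on `X`, multiplied with the `p`-th coordinate of the code. -/
noncomputable def codedFunction (h : BoundedContinuousFunction X ℝ) (p : ℕ) :
    BoundedContinuousFunction (X × (ℕ → Bool)) ℝ :=
  BoundedContinuousFunction.mkOfCompact
    ⟨fun y => (if y.2 p = true then 1 else 0) * h y.1, by
      refine Continuous.mul ?_ (h.continuous.comp continuous_fst)
      exact (continuous_of_discreteTopology (f := fun b : Bool => if b = true then (1 : ℝ) else 0)).comp
        ((continuous_apply p).comp continuous_snd)⟩

theorem codedFunction_eq_indicator (h : BoundedContinuousFunction X ℝ) (p : ℕ) :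
    ⇑(codedFunction h p) =
      {y : X × (ℕ → Bool) | y.2 p = true}.indicator fun y => h y.1 := by
  ext y
  change (if y.2 p = true then 1 else 0) * h y.1 = _
  by_cases hy : y.2 p = true
  · rw [if_pos hy, one_mul, Set.indicator_of_mem (by exact hy)]
  · rw [if_neg hy, zero_mul, Set.indicator_of_notMem (by exact hy)]

theorem isClopen_setOf_apply_eq_true (X : Type*) [TopologicalSpace X] (p : ℕ) :
    IsClopen {y : X × (ℕ → Bool) | y.2 p = true} :=
  (isClopen_discrete {true}).preimage ((continuous_apply p).comp continuous_snd)

variable [MeasurableSpace X] [BorelSpace X]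

/-- Given measurable sets `N k p` decreasing in `p`, the restrictions of probability measures `ν k`
to the sets `N k p` converge along a subsequence for all `p`, and their limits decrease to a
measure `m₀`; the limit of `ν k` splits as `m₀ + m₁`. -/
theorem exists_subseq_tendsto_restrict (ν : ℕ → ProbabilityMeasure X) (N : ℕ → ℕ → Set X)
    (hN : ∀ k p, MeasurableSet (N k p)) (hanti : ∀ k, Antitone (N k)) :
    ∃ (κ : ℕ → ℕ) (m₀ m₁ : FiniteMeasure X) (m : ℕ → FiniteMeasure X), StrictMono κ ∧
      (∀ p (h : BoundedContinuousFunction X ℝ),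
        Tendsto (fun i => ∫ x in N (κ i) p, h x ∂(ν (κ i) : Measure X)) atTop
          (𝓝 (∫ x, h x ∂(m p : Measure X)))) ∧
      (∀ h : BoundedContinuousFunction X ℝ,
        Tendsto (fun p => ∫ x, h x ∂(m p : Measure X)) atTop
          (𝓝 (∫ x, h x ∂(m₀ : Measure X)))) ∧
      Tendsto (fun i => (ν (κ i)).toFiniteMeasure) atTop (𝓝 (m₀ + m₁)) ∧
      ∀ B : Set X, MeasurableSet B → (∀ p, ∃ G : ℕ → Set X, (∀ K, IsOpen (G K)) ∧
        (∀ K, ∀ᶠ k in atTop, G K ⊆ N k p) ∧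
        ((m₀ + m₁ : FiniteMeasure X) : Measure X) (B \ ⋃ K, G K) = 0) →
        (m₁ : Measure X) B = 0 := by
  have hcm : ∀ k, Measurable (codingMap (N k)) := fun k => measurable_codingMap (hN k)
  -- The lifted measures live on a compact space where membership in the `p`-th set is a clopen
  -- condition. One convergent subsequence thus yields the limits of the restrictions for every `p`,
  -- all as parts of one measure `ρ`.
  set ρs : ℕ → ProbabilityMeasure (X × (ℕ → Bool)) := fun k =>
    (ν k).map (hcm k).aemeasurable with hρs
  obtain ⟨ρ, κ, hκ, hρ⟩ := CompactSpace.tendsto_subseq ρs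
  set E : ℕ → Set (X × (ℕ → Bool)) := fun p => {y | y.2 p = true} with hE
  have hEc : ∀ p, IsClopen (E p) := fun p => isClopen_setOf_apply_eq_true X p
  have hEm : ∀ p, MeasurableSet (E p) := fun p => (hEc p).isOpen.measurableSet
  have hEim : MeasurableSet (⋂ p, E p) := MeasurableSet.iInter hEm
  have hpre : ∀ k p, codingMap (N k) ⁻¹' E p = N k p := fun k p =>
    Set.ext fun x => codingMap_snd (N k) x p
  have hmap : ∀ k, (ρs k : Measure (X × (ℕ → Bool))) = (ν k : Measure X).map (codingMap (N k)) :=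
    fun k => rfl
  let res : Set (X × (ℕ → Bool)) → FiniteMeasure X := fun s =>
    ⟨((ρ : Measure (X × (ℕ → Bool))).restrict s).map Prod.fst, inferInstance⟩
  have hres : ∀ s (h : BoundedContinuousFunction X ℝ),
      ∫ x, h x ∂(res s : Measure X) = ∫ y in s, h y.1 ∂(ρ : Measure (X × (ℕ → Bool))) :=
    fun s h => integral_map measurable_fst.aemeasurable h.continuous.aestronglyMeasurable
  have hresApply : ∀ s (B : Set X), MeasurableSet B →
      (res s : Measure X) B = (ρ : Measure (X × (ℕ → Bool))) (Prod.fst ⁻¹' B ∩ s) := by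
    intro s B hB
    change ((ρ : Measure (X × (ℕ → Bool))).restrict s).map Prod.fst B = _
    rw [Measure.map_apply measurable_fst hB, Measure.restrict_apply (measurable_fst hB)]
  have hint : ∀ h : BoundedContinuousFunction X ℝ,
      Integrable (fun y => h y.1) (ρ : Measure (X × (ℕ → Bool))) := fun h =>
    integrable_of_abs_le (h.continuous.comp continuous_fst).measurable fun y => h.norm_coe_le_norm _
  refine ⟨κ, res (⋂ p, E p), res (⋂ p, E p)ᶜ, fun p => res (E p), hκ, ?_, ?_, ?_, ?_⟩
  · intro p h
    have := (ProbabilityMeasure.tendsto_iff_forall_integral_tendsto.1 hρ) (codedFunction h p)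
    simp only [codedFunction_eq_indicator] at this
    rw [integral_indicator (hEm p), ← hres] at this
    refine this.congr fun i => ?_
    rw [Function.comp_apply, hmap, integral_indicator (hEm p),
      setIntegral_map (hEm p) _ (hcm _).aemeasurable]
    · rw [hpre]; rfl
    · exact (h.continuous.comp continuous_fst).aestronglyMeasurable
  · intro h
    -- The codes need not be monotone on the whole product, but a violation is an open event of
    -- measure zero for every lift, hence `ρ`-null.
    have hEanti : ∀ᵐ y ∂(ρ : Measure (X × (ℕ → Bool))), ∀ p q, p ≤ q → y ∈ E q → y ∈ E p := by
      refine ae_all_iff.2 fun p => ae_all_iff.2 fun q => ae_all_iff.2 fun hpq => ?_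
      have h0 : (ρ : Measure (X × (ℕ → Bool))) (E q ∩ (E p)ᶜ) = 0 := by
        refine measure_eq_zero_of_tendsto hρ ((hEc q).isOpen.inter (hEc p).compl.isOpen)
          (Eventually.of_forall fun i => ?_)
        rw [Function.comp_apply, hmap, Measure.map_apply (hcm _) ((hEm q).inter (hEm p).compl),
          Set.preimage_inter, Set.preimage_compl, hpre, hpre,
          (Set.disjoint_compl_right_iff_subset.2 (hanti _ hpq)).inter_eq, measure_empty]
      filter_upwards [measure_eq_zero_iff_ae_notMem.1 h0] with y hy hyq
      by_contra hyp
      exact hy ⟨hyq, hyp⟩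
    simp only [hres]
    simp only [← integral_indicator (hEm _), ← integral_indicator hEim]
    refine tendsto_integral_of_dominated_convergence (fun _ => ‖h‖)
      (fun p => ((hint h).indicator (hEm p)).aestronglyMeasurable) (integrable_const _)
      (fun p => Eventually.of_forall fun y =>
        (norm_indicator_le_norm_self _ _).trans (h.norm_coe_le_norm _)) ?_
    filter_upwards [hEanti] with y hy
    by_cases hyE : y ∈ ⋂ p, E p
    · rw [Set.indicator_of_mem hyE]
      refine tendsto_const_nhds.congr fun p => ?_
      rw [Set.indicator_of_mem (Set.mem_iInter.1 hyE p)]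
    · rw [Set.indicator_of_notMem hyE]
      rw [Set.mem_iInter, not_forall] at hyE
      obtain ⟨p, hp⟩ := hyE
      refine tendsto_const_nhds.congr' ?_
      filter_upwards [eventually_ge_atTop p] with q hq
      rw [Set.indicator_of_notMem fun hyq => hp (hy p q hq hyq)]
  · refine FiniteMeasure.tendsto_of_forall_integral_tendsto fun h => ?_
    have := (ProbabilityMeasure.tendsto_iff_forall_integral_tendsto.1 hρ)
      (h.compContinuous ⟨Prod.fst, continuous_fst⟩)
    rw [FiniteMeasure.toMeasure_add, integral_add_measure (h.integrable _) (h.integrable _),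
      hres, hres, integral_add_compl hEim (hint h)]
    refine this.congr fun i => ?_
    rw [Function.comp_apply, hmap, integral_map (hcm _).aemeasurable
      (BoundedContinuousFunction.continuous _).aestronglyMeasurable]
    rfl
  · intro B hB hG
    rw [hresApply _ B hB, Set.compl_iInter, Set.inter_iUnion]
    refine measure_iUnion_null fun p => ?_
    obtain ⟨G, hGo, hGN, hG0⟩ := hG p
    have hU : MeasurableSet (⋃ K, G K) := (isOpen_iUnion hGo).measurableSet
    -- The first part is null by assumption. Each set in the second is open and eventually null for
    -- the lifts, because `G K` lies in the `p`-th set.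
    have hsub : Prod.fst ⁻¹' B ∩ (E p)ᶜ ⊆ Prod.fst ⁻¹' (B \ ⋃ K, G K) ∪
        ⋃ K, (Prod.fst ⁻¹' G K ∩ (E p)ᶜ) := by
      rintro y ⟨hyB, hyE⟩
      by_cases hy : y.1 ∈ ⋃ K, G K
      · obtain ⟨K, hK⟩ := Set.mem_iUnion.1 hy
        exact Or.inr (Set.mem_iUnion.2 ⟨K, hK, hyE⟩)
      · exact Or.inl ⟨hyB, hy⟩
    refine measure_mono_null hsub (measure_union_null ?_ (measure_iUnion_null fun K => ?_))
    · rw [FiniteMeasure.toMeasure_add, Measure.add_apply, hresApply _ _ (hB.diff hU),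
        hresApply _ _ (hB.diff hU)] at hG0
      rw [← measure_inter_add_sdiff _ hEim]
      exact hG0
    · refine measure_eq_zero_of_tendsto hρ
        (((hGo K).preimage continuous_fst).inter (hEc p).compl.isOpen) ?_
      filter_upwards [hκ.tendsto_atTop.eventually (hGN K)] with i hi
      rw [Function.comp_apply, hmap, Measure.map_apply (hcm _)
        ((measurable_fst (hGo K).measurableSet).inter (hEm p).compl), Set.preimage_inter,
        Set.preimage_compl, hpre]
      have : codingMap (N (κ i)) ⁻¹' (Prod.fst ⁻¹' G K) = G K := rfl
      rw [this, (Set.disjoint_compl_right_iff_subset.2 hi).inter_eq, measure_empty]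

end Coding

/-! ### Uniform convergence of iterates and of integrands -/

section UniformLimits

variable {X : Type*} [MetricSpace X] [CompactSpace X] {f : X ≃ₜ X} {fk : ℕ → X ≃ₜ X}

theorem tendstoUniformly_comp {g : X → X} {gk : ℕ → X → X} {Y : Type*} [MetricSpace Y] {h : X → Y}
    {hk : ℕ → X → Y} (hh : Continuous h) (hlim : TendstoUniformly hk h atTop)
    (hg : TendstoUniformly gk g atTop) :
    TendstoUniformly (fun k x => hk k (gk k x)) (fun x => h (g x)) atTop := by
  have hu := CompactSpace.uniformContinuous_of_continuous hh
  refine Metric.tendstoUniformly_iff.2 fun ε hε => ?_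
  have h1 := Metric.tendstoUniformly_iff.1 (hu.comp_tendstoUniformly hg) (ε / 2) (by linarith)
  have h2 := Metric.tendstoUniformly_iff.1 hlim (ε / 2) (by linarith)
  filter_upwards [h1, h2] with k h1 h2 x
  calc dist (h (g x)) (hk k (gk k x)) ≤ dist (h (g x)) (h (gk k x)) +
        dist (h (gk k x)) (hk k (gk k x)) := dist_triangle _ _ _
    _ < ε / 2 + ε / 2 := add_lt_add (h1 x) (h2 _)
    _ = ε := by ring

theorem tendstoUniformly_symm (h : TendstoUniformly (fun k x => fk k x) (fun x => f x) atTop) :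
    TendstoUniformly (fun k x => (fk k).symm x) (fun x => f.symm x) atTop := by
  have hu := CompactSpace.uniformContinuous_of_continuous f.symm.continuous
  refine Metric.tendstoUniformly_iff.2 fun ε hε => ?_
  filter_upwards [Metric.tendstoUniformly_iff.1 (hu.comp_tendstoUniformly h) ε hε] with k hk y
  have := hk ((fk k).symm y)
  simp only [Function.comp_apply, Homeomorph.symm_apply_apply, Homeomorph.apply_symm_apply] at this
  rwa [dist_comm]

theorem tendstoUniformly_pow (h : TendstoUniformly (fun k x => fk k x) (fun x => f x) atTop)
    (n : ℕ) : TendstoUniformly (fun k x => (fk k ^ n) x) (fun x => (f ^ n) x) atTop := by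
  induction n with
  | zero =>
    simp only [pow_zero]
    exact Metric.tendstoUniformly_iff.2 fun ε hε => Eventually.of_forall fun k x => by simpa using hε
  | succ n ih =>
    simp only [pow_succ]
    exact tendstoUniformly_comp (h := fun x => (f ^ n) x) (hk := fun k x => (fk k ^ n) x)
      (f ^ n).continuous ih h

theorem tendstoUniformly_zpow (h : TendstoUniformly (fun k x => fk k x) (fun x => f x) atTop)
    (j : ℤ) : TendstoUniformly (fun k x => (fk k ^ j) x) (fun x => (f ^ j) x) atTop := by
  obtain ⟨n, rfl | rfl⟩ := j.eq_nat_or_neg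
  · simp only [zpow_natCast]
    exact tendstoUniformly_pow h n
  · simp only [zpow_neg, zpow_natCast]
    exact tendstoUniformly_symm (tendstoUniformly_pow h n)

theorem tendsto_setIntegral_of_tendstoUniformly {X : Type*} [MeasurableSpace X]
    {ν : ℕ → ProbabilityMeasure X} {S : ℕ → Set X} {h : X → ℝ} {hk : ℕ → X → ℝ} {I : ℝ}
    (hi : ∀ k, Integrable h (ν k : Measure X)) (hki : ∀ k, Integrable (hk k) (ν k : Measure X))
    (hlim : TendstoUniformly hk h atTop)
    (hI : Tendsto (fun k => ∫ x in S k, h x ∂(ν k : Measure X)) atTop (𝓝 I)) :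
    Tendsto (fun k => ∫ x in S k, hk k x ∂(ν k : Measure X)) atTop (𝓝 I) := by
  have h0 : Tendsto (fun k => ∫ x in S k, hk k x ∂(ν k : Measure X) -
      ∫ x in S k, h x ∂(ν k : Measure X)) atTop (𝓝 0) := by
    refine Metric.tendsto_nhds.2 fun ε hε => ?_
    filter_upwards [Metric.tendstoUniformly_iff.1 hlim (ε / 2) (by linarith)] with k hk'
    rw [Real.dist_eq, sub_zero]
    refine (abs_setIntegral_sub_le (S k) (hki k) (hi k) (δ := ε / 2) fun x => ?_).trans_lt
      (by linarith)
    rw [abs_sub_comm]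
    exact (hk' x).le
  simpa using h0.add hI

end UniformLimits

/-! ### Points with nonpositive Birkhoff averages -/

section NonpositiveAverages

variable {X : Type*} [TopologicalSpace X] {f : X ≃ₜ X} {φ : X → ℝ}

/-- The points for which `[a, b)` is a neutral block around `0` of length at least `L`, with strict
inequalities. -/
def strictNeutralLocus (α L : ℝ) (f : X ≃ₜ X) (φ : X → ℝ) (a b : ℤ) : Set X :=
  {x | (L ≤ (b : ℝ) - a ∧ a ≤ 0 ∧ 0 < b) ∧
    ∀ n ∈ Finset.Ioc a b, ∑ j ∈ Finset.Ico a n, φ ((f ^ j) x) < α * ((n : ℝ) - a)}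

theorem isOpen_strictNeutralLocus (hφ : Continuous φ) (α L : ℝ) (a b : ℤ) :
    IsOpen (strictNeutralLocus α L f φ a b) := by
  simp only [strictNeutralLocus, Set.ofPred_and, Set.ofPred_forall]
  refine (isOpen_const.inter (isOpen_const.inter isOpen_const)).inter
    (isOpen_biInter_finset fun n _ => isOpen_lt ?_ continuous_const)
  exact continuous_finsetSum _ fun j _ => hφ.comp (f ^ j).continuous

/-- The sequence starts at `0` and is eventually negative. Without such an `n₀`, one could pass
forever to later times with values at least as large, all nonnegative. -/
theorem exists_forall_birkhoffSum_sub_lt {X : Type*} {T : X → X} {φ : X → ℝ} {x : X} {α l : ℝ}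
    (hl : l < α)
    (hx : Tendsto (fun n => birkhoffAverage ℝ T φ n x) atTop (𝓝 l)) :
    ∃ n₀ : ℕ, ∀ n > n₀, birkhoffSum T φ n x - α * n < birkhoffSum T φ n₀ x - α * n₀ := by
  have hev : ∀ᶠ n in atTop, birkhoffSum T φ n x - α * n < 0 := by
    filter_upwards [hx.eventually_lt_const hl, eventually_ge_atTop 1] with n hn hn1
    have hn0 : (0 : ℝ) < n := by exact_mod_cast hn1
    rw [birkhoffAverage, smul_eq_mul, inv_mul_lt_iff₀ hn0] at hn
    linarith
  by_contra! h
  have hfr : ∀ N : ℕ, ∃ n ≥ N, 0 ≤ birkhoffSum T φ n x - α * n := by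
    intro N
    induction N with
    | zero => exact ⟨0, le_rfl, by simp⟩
    | succ N ih =>
      obtain ⟨n, hn, hn0⟩ := ih
      obtain ⟨n', hn', hn0'⟩ := h n
      exact ⟨n', by omega, hn0.trans hn0'⟩
  obtain ⟨N, hN⟩ := eventually_atTop.1 hev
  obtain ⟨n, hn, hn0⟩ := hfr N
  exact absurd (hN n hn) (not_lt.2 hn0)

theorem eventually_mem_strictNeutralLocus {x : X} {α l : ℝ} (L : ℝ) (hl : l < α)
    (hx : Tendsto (fun n => birkhoffAverage ℝ f φ n x) atTop (𝓝 l)) :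
    ∀ᶠ n : ℕ in atTop, ∃ a b, f^[n] x ∈ strictNeutralLocus α L f φ a b := by
  obtain ⟨n₀, hn₀⟩ := exists_forall_birkhoffSum_sub_lt hl hx
  filter_upwards [eventually_ge_atTop n₀] with n hn
  -- Seen from time `n`, the block starts at `n₀`. Its right end is arbitrary, so it is placed
  -- beyond `0` and far enough for length `L`.
  refine ⟨n₀ - n, max 1 (n₀ - n + ⌈L⌉), ⟨?_, by omega, by omega⟩, fun m hm => ?_⟩
  · have h1 : ((n₀ - n + ⌈L⌉ : ℤ) : ℝ) ≤ (max 1 (n₀ - n + ⌈L⌉) : ℤ) := by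
      exact_mod_cast le_max_right _ _
    have h2 := Int.le_ceil L
    push_cast at h1 ⊢
    linarith
  · rw [Finset.mem_Ioc] at hm
    rw [← zpow_natCast_apply, sum_zpow_apply_zpow, sub_add_cancel]
    obtain ⟨k, hk⟩ := Int.eq_ofNat_of_zero_le (by omega : 0 ≤ m + n)
    have h1 := hn₀ k (by omega)
    rw [birkhoffSum_eq_sum_zpow, birkhoffSum_eq_sum_zpow, ← sum_Ico_int_consecutive _
      (Int.natCast_nonneg n₀) (by omega : (n₀ : ℤ) ≤ k)] at h1
    rw [hk]
    have h2 : (m : ℝ) + n = k := by exact_mod_cast hk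
    push_cast
    have h3 : (m : ℝ) - (n₀ - n) = k - n₀ := by linarith
    rw [h3]
    linarith

/-- Poincaré recurrence: almost every point of the difference returns to it infinitely often,
whereas its orbit eventually stays in the union. -/
theorem measure_diff_iUnion_strictNeutralLocus_eq_zero [MeasurableSpace X] [BorelSpace X]
    {μ : Measure X} [IsFiniteMeasure μ] (hf : MeasurePreserving f μ μ) (hφ : Continuous φ)
    {G : X → ℝ} (hGm : Measurable G)
    (hG : ∀ᵐ x ∂μ, Tendsto (fun n => birkhoffAverage ℝ f φ n x) atTop (𝓝 (G x))) {α : ℝ}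
    (hα : 0 < α) (L : ℝ) :
    μ ({x | G x ≤ 0} \ ⋃ c : ℤ × ℤ, strictNeutralLocus α L f φ c.1 c.2) = 0 := by
  set Z := {x | G x ≤ 0} \ ⋃ c : ℤ × ℤ, strictNeutralLocus α L f φ c.1 c.2 with hZ
  have hZm : MeasurableSet Z := (measurableSet_le hGm measurable_const).diff
    (isOpen_iUnion fun c : ℤ × ℤ => isOpen_strictNeutralLocus hφ α L c.1 c.2).measurableSet
  rw [measure_eq_zero_iff_ae_notMem]
  filter_upwards [hG, hf.conservative.ae_mem_imp_frequently_image_mem hZm.nullMeasurableSet]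
    with x hx hrec hxZ
  obtain ⟨n, hn, a, b, hab⟩ :=
    ((hrec hxZ).and_eventually (eventually_mem_strictNeutralLocus L (hxZ.1.trans_lt hα) hx)).exists
  exact hn.2 (Set.mem_iUnion.2 ⟨(a, b), hab⟩)

/-- A fixed block involves finitely many iterates, so the perturbation costs less than α / 2 per
step, which the halved slope absorbs. -/
theorem eventually_strictNeutralLocus_subset {X : Type*} [MetricSpace X] [CompactSpace X]
    {f : X ≃ₜ X} {fk : ℕ → X ≃ₜ X} {φ : X → ℝ} {φk : ℕ → X → ℝ} (hφ : Continuous φ)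
    (hf_lim : TendstoUniformly (fun k x => fk k x) (fun x => f x) atTop)
    (hφ_lim : TendstoUniformly φk φ atTop) {α : ℝ} (hα : 0 < α) (L : ℝ) (a b : ℤ) :
    ∀ᶠ k in atTop, strictNeutralLocus (α / 2) L f φ a b ⊆ neutralLocus α L (fk k) (φk k) := by
  have h : ∀ᶠ k in atTop, ∀ j ∈ Finset.Ico a b, ∀ x,
      dist (φ ((f ^ j) x)) (φk k ((fk k ^ j) x)) < α / 2 :=
    (eventually_all_finset _).2 fun j _ => Metric.tendstoUniformly_iff.1
      (tendstoUniformly_comp hφ hφ_lim (tendstoUniformly_zpow hf_lim j)) _ (by linarith)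
  filter_upwards [h] with k hk
  rintro x ⟨⟨hL, ha, hb⟩, hx⟩
  refine ⟨a, b, ⟨hL, fun n hn hn' => ?_⟩, ha, hb⟩
  have h1 := hx n (Finset.mem_Ioc.2 ⟨hn, hn'⟩)
  have h2 : ∑ j ∈ Finset.Ico a n, φk k ((fk k ^ j) x) ≤
      ∑ j ∈ Finset.Ico a n, (φ ((f ^ j) x) + α / 2) := by
    refine Finset.sum_le_sum fun j hj => ?_
    rw [Finset.mem_Ico] at hj
    have := hk j (Finset.mem_Ico.2 ⟨hj.1, by omega⟩) x
    rw [Real.dist_eq, abs_lt] at this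
    linarith
  rw [Finset.sum_add_distrib, Finset.sum_const, Int.card_Ico, nsmul_eq_mul] at h2
  have h3 : (((n - a).toNat : ℕ) : ℝ) = n - a := by
    have : (((n - a).toNat : ℕ) : ℤ) = n - a := by omega
    exact_mod_cast this
  rw [h3] at h2
  linarith

end NonpositiveAverages

/-! ### Iterated limits and the properties of the two limit measures -/

section MainTheorem

variable {X : Type*} [MetricSpace X] [MeasurableSpace X] [BorelSpace X]

theorem measurePreserving_of_forall_integral_comp_eq {f : X ≃ₜ X} {m : Measure X}
    [IsFiniteMeasure m]
    (h : ∀ g : BoundedContinuousFunction X ℝ, ∫ x, g (f x) ∂m = ∫ x, g x ∂m) :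
    MeasurePreserving f m m := by
  refine ⟨f.continuous.measurable, ?_⟩
  refine ext_of_forall_integral_eq_of_IsFiniteMeasure fun g => ?_
  rw [integral_map f.continuous.measurable.aemeasurable g.continuous.aestronglyMeasurable, h]

/-- Iterated limits: first `i → ∞`, then `α → 0` and `L → ∞`. -/
def neutralFilter : Filter ((ℝ × ℝ) × ℕ) :=
  (𝓝[>] (0 : ℝ) ×ˢ (atTop : Filter ℝ)).curry atTop

theorem eventually_neutralFilter_iff {P : (ℝ × ℝ) × ℕ → Prop} :
    (∀ᶠ q in neutralFilter, P q) ↔ ∃ αstar : ℝ, 0 < αstar ∧ ∃ Lstar : ℝ, 1 ≤ Lstar ∧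
      ∀ α : ℝ, 0 < α → α < αstar → ∀ L : ℝ, Lstar ≤ L → ∃ istar : ℕ, ∀ i ≥ istar,
        P ((α, L), i) := by
  rw [neutralFilter, eventually_curry_iff]
  simp only [← eventually_atTop (α := ℕ)]
  constructor
  · intro h
    obtain ⟨p, hp, q, hq, hpq⟩ := eventually_prod_iff.1 h
    obtain ⟨a, ha, hap⟩ := mem_nhdsGT_iff_exists_Ioo_subset.1 hp
    obtain ⟨l, hl⟩ := eventually_atTop.1 hq
    exact ⟨a, ha, max 1 l, le_max_left _ _, fun α h0 h1 L hL =>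
      hpq (hap ⟨h0, h1⟩) (hl L ((le_max_right _ _).trans hL))⟩
  · rintro ⟨a, ha, l, -, h⟩
    refine eventually_prod_iff.2 ⟨_, Ioo_mem_nhdsGT ha, _, eventually_ge_atTop l, ?_⟩
    intro α hα L hL
    exact h α hα.1 hα.2 L hL

theorem tendsto_snd_neutralFilter : Tendsto Prod.snd neutralFilter atTop := by
  intro s hs
  exact eventually_neutralFilter_iff.2 ⟨1, one_pos, 1, le_rfl, fun _ _ _ _ _ =>
    eventually_atTop.1 hs⟩

theorem exists_nat_one_div_le_and_le {α : ℝ} (hα : 0 < α) (L : ℝ) (p : ℕ) :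
    ∃ q ≥ p, 1 / ((q : ℝ) + 1) ≤ α ∧ L ≤ q + 1 := by
  obtain ⟨q₁, h₁⟩ := exists_nat_one_div_lt hα
  obtain ⟨q₂, h₂⟩ := exists_nat_ge L
  refine ⟨max p (max q₁ q₂), le_max_left _ _, ?_, ?_⟩
  · refine le_trans ?_ h₁.le
    have : (q₁ : ℝ) ≤ (max p (max q₁ q₂) : ℕ) := by
      exact_mod_cast (le_max_left _ _).trans (le_max_right _ _)
    gcongr
  · have : (q₂ : ℝ) ≤ (max p (max q₁ q₂) : ℕ) := by
      exact_mod_cast (le_max_right _ _).trans (le_max_right _ _)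
    linarith

theorem abs_setIntegral_sub_setIntegral_le {X : Type*} [MeasurableSpace X] {ν : Measure X}
    [IsFiniteMeasure ν] {A N B : Set X} (hA : MeasurableSet A) (hN : MeasurableSet N) (hAN : A ⊆ N)
    (hNB : N ⊆ B) {h : X → ℝ} (hi : Integrable h ν) {C : ℝ} (hC : ∀ x, |h x| ≤ C) :
    |∫ x in B, h x ∂ν - ∫ x in N, h x ∂ν| ≤ C * (ν.real B - ν.real A) := by
  rw [← setIntegral_sdiff hN hi.integrableOn hNB, ← Real.norm_eq_abs]
  refine (norm_setIntegral_le_of_norm_le_const (measure_lt_top _ _) fun x _ => hC x).trans ?_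
  rcases Set.eq_empty_or_nonempty (B \ N) with he | ⟨x₀, -⟩
  · rcases isEmpty_or_nonempty X with hX | ⟨⟨x₀⟩⟩
    · simp [Set.eq_empty_of_isEmpty]
    · have hC0 : 0 ≤ C := (abs_nonneg _).trans (hC x₀)
      rw [← measureReal_sdiff (hAN.trans hNB) hA]
      gcongr
      finiteness
  · have hC0 : 0 ≤ C := (abs_nonneg _).trans (hC x₀)
    rw [← measureReal_sdiff (hAN.trans hNB) hA]
    gcongr
    finiteness

/-- Monotonicity squeezes the set for (α, L) between two sets of the diagonal family, with indices
`q ≥ p`. For large `p` both have mass close to that of `m₀`, so little lies between them. -/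
theorem tendsto_restrictFinite_neutralFilter {ν : ℕ → ProbabilityMeasure X}
    {N : ℝ → ℝ → ℕ → Set X} (hN : ∀ α L i, MeasurableSet (N α L i))
    (hmono : ∀ {α α' L L'} i, α' ≤ α → L ≤ L' → N α' L' i ⊆ N α L i)
    {m₀ : FiniteMeasure X} {m : ℕ → FiniteMeasure X}
    (hm : ∀ (p : ℕ) (h : BoundedContinuousFunction X ℝ),
      Tendsto (fun i => ∫ x in N (1 / ((p : ℝ) + 1)) (p + 1) i, h x ∂(ν i : Measure X)) atTop
        (𝓝 (∫ x, h x ∂(m p : Measure X))))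
    (hm₀ : ∀ h : BoundedContinuousFunction X ℝ,
      Tendsto (fun p => ∫ x, h x ∂(m p : Measure X)) atTop (𝓝 (∫ x, h x ∂(m₀ : Measure X)))) :
    Tendsto (fun q : (ℝ × ℝ) × ℕ => restrictFinite (ν q.2) (N q.1.1 q.1.2 q.2)) neutralFilter
      (𝓝 m₀) := by
  refine FiniteMeasure.tendsto_of_forall_integral_tendsto fun h => ?_
  change Tendsto (fun q : (ℝ × ℝ) × ℕ => ∫ x in N q.1.1 q.1.2 q.2, h x ∂(ν q.2 : Measure X)) _ _
  refine Metric.tendsto_nhds.2 fun ε hε => eventually_neutralFilter_iff.2 ?_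
  -- Four errors of size `δ` occur: the masses of the sets `p` and `q` against their limits, and
  -- those limits against the mass of `m₀`.
  set δ := ε / (8 * (‖h‖ + 1)) with hδ
  have hδ0 : 0 < δ := by positivity
  have hδε : ‖h‖ * (4 * δ) < ε / 2 := by
    have : (‖h‖ + 1) * (4 * δ) = ε / 2 := by rw [hδ]; field_simp; ring
    nlinarith
  have hone : ∀ (p : ℕ), Tendsto (fun i => (ν i : Measure X).real (N (1 / ((p : ℝ) + 1)) (p + 1) i))
      atTop (𝓝 ((m p : Measure X).real Set.univ)) := fun p => by
    simpa using hm p (BoundedContinuousFunction.const X 1)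
  have hone₀ : Tendsto (fun p => (m p : Measure X).real Set.univ) atTop
      (𝓝 ((m₀ : Measure X).real Set.univ)) := by
    simpa using hm₀ (BoundedContinuousFunction.const X 1)
  obtain ⟨p, hp⟩ := eventually_atTop.1 ((Metric.tendsto_nhds.1 hone₀ δ hδ0).and
    (Metric.tendsto_nhds.1 (hm₀ h) (ε / 4) (by linarith)))
  refine ⟨1 / ((p : ℝ) + 1), by positivity, p + 1, by simp, fun α hα hαp L hL => ?_⟩
  obtain ⟨q, hqp, hqα, hqL⟩ := exists_nat_one_div_le_and_le hα L p
  refine eventually_atTop.1 ?_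
  filter_upwards [Metric.tendsto_nhds.1 (hone p) δ hδ0, Metric.tendsto_nhds.1 (hone q) δ hδ0,
    Metric.tendsto_nhds.1 (hm p h) (ε / 4) (by linarith)] with i h1 h2 h3
  have h4 := (hp p le_rfl).1
  have h5 := (hp p le_rfl).2
  have h6 := (hp q hqp).1
  have h7 := abs_setIntegral_sub_setIntegral_le (hN _ _ i) (hN α L i) (hmono i hqα hqL)
    (hmono i hαp.le hL) (h.integrable (ν i : Measure X)) h.norm_coe_le_norm
  rw [Real.dist_eq, abs_lt] at *
  have h8 : ‖h‖ * ((ν i : Measure X).real (N (1 / ((p : ℝ) + 1)) (p + 1) i) -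
      (ν i : Measure X).real (N (1 / ((q : ℝ) + 1)) (q + 1) i)) ≤ ‖h‖ * (4 * δ) :=
    mul_le_mul_of_nonneg_left (by linarith) (norm_nonneg _)
  have h9 := abs_le.1 (h7.trans h8)
  constructor <;> linarith

theorem tendsto_restrictFinite_compl {ι : Type*} {l : Filter ι} {ν : ι → ProbabilityMeasure X}
    {N : ι → Set X} (hN : ∀ i, MeasurableSet (N i)) {m₀ m₁ : FiniteMeasure X}
    (hν : Tendsto (fun i => (ν i).toFiniteMeasure) l (𝓝 (m₀ + m₁)))
    (h₀ : Tendsto (fun i => restrictFinite (ν i) (N i)) l (𝓝 m₀)) :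
    Tendsto (fun i => restrictFinite (ν i) (N i)ᶜ) l (𝓝 m₁) := by
  rw [FiniteMeasure.tendsto_iff_forall_integral_tendsto] at hν h₀ ⊢
  intro h
  have := (hν h).sub (h₀ h)
  rw [FiniteMeasure.toMeasure_add, integral_add_measure (h.integrable _) (h.integrable _),
    add_sub_cancel_left] at this
  refine this.congr fun i => ?_
  change ∫ x, h x ∂(ν i : Measure X) - ∫ x in N i, h x ∂(ν i : Measure X) =
    ∫ x in (N i)ᶜ, h x ∂(ν i : Measure X)
  rw [← integral_add_compl (hN i) (h.integrable (ν i : Measure X)), add_sub_cancel_left]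

theorem tendsto_const_div_natCast_add_one (C : ℝ) :
    Tendsto (fun p : ℕ => C * (1 / ((p : ℝ) + 1))) atTop (𝓝 0) := by
  simpa using (tendsto_one_div_add_atTop_nhds_zero_nat (𝕜 := ℝ)).const_mul C

theorem measureReal_preimage_diff_neutralLocus_le {f : X ≃ₜ X} {φ : X → ℝ} (hφ : Continuous φ)
    {ν : Measure X} [IsProbabilityMeasure ν] (hf : MeasurePreserving f ν ν) (α : ℝ) (p : ℕ) :
    ν.real (f ⁻¹' neutralLocus α (p + 1) f φ \ neutralLocus α (p + 1) f φ) ≤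
      1 / ((p : ℝ) + 1) := by
  have h := natCast_mul_measureReal_preimage_diff_le (α := α) (L := p + 1) hf hφ (l := p + 1)
    (by simp)
  rw [le_div_iff₀ (by positivity), mul_comm]
  exact_mod_cast h

variable [CompactSpace X] {f : X ≃ₜ X} {fk : ℕ → X ≃ₜ X} {φ : X → ℝ} {φk : ℕ → X → ℝ}
  {ν : ℕ → ProbabilityMeasure X} {m₀ : FiniteMeasure X} {m : ℕ → FiniteMeasure X}

theorem measurePreserving_of_tendsto_restrict (hφk : ∀ k, Continuous (φk k))
    (hf_lim : TendstoUniformly (fun k x => fk k x) (fun x => f x) atTop)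
    (hν : ∀ k, Ergodic (fk k) (ν k : Measure X))
    (hm : ∀ (p : ℕ) (h : BoundedContinuousFunction X ℝ),
      Tendsto (fun k => ∫ x in neutralLocus (1 / ((p : ℝ) + 1)) (p + 1) (fk k) (φk k), h x
        ∂(ν k : Measure X)) atTop (𝓝 (∫ x, h x ∂(m p : Measure X))))
    (hm₀ : ∀ h : BoundedContinuousFunction X ℝ,
      Tendsto (fun p => ∫ x, h x ∂(m p : Measure X)) atTop (𝓝 (∫ x, h x ∂(m₀ : Measure X)))) :
    MeasurePreserving f (m₀ : Measure X) (m₀ : Measure X) := by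
  refine measurePreserving_of_forall_integral_comp_eq fun h => ?_
  have hcomp : TendstoUniformly (fun k x => h (fk k x)) (fun x => h (f x)) atTop :=
    (CompactSpace.uniformContinuous_of_continuous h.continuous).comp_tendstoUniformly hf_lim
  set hf : BoundedContinuousFunction X ℝ := h.compContinuous ⟨f, f.continuous⟩ with hhf
  have hp : ∀ p : ℕ, |∫ x, hf x ∂(m p : Measure X) - ∫ x, h x ∂(m p : Measure X)| ≤
      2 * ‖h‖ * (1 / ((p : ℝ) + 1)) := by
    intro p
    have h1 := tendsto_setIntegral_of_tendstoUniformly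
      (fun k => hf.integrable (ν k : Measure X))
      (fun k => (h.compContinuous ⟨fk k, (fk k).continuous⟩).integrable (ν k : Measure X))
      hcomp (hm p hf)
    refine le_of_tendsto' (h1.sub (hm p h)).abs fun k => ?_
    refine (abs_setIntegral_comp_sub_le (hν k).toMeasurePreserving
      (measurableSet_neutralLocus (hφk k)) h.continuous.measurable h.norm_coe_le_norm).trans ?_
    gcongr
    exact measureReal_preimage_diff_neutralLocus_le (hφk k) (hν k).toMeasurePreserving _ p
  have hlim := ((hm₀ hf).sub (hm₀ h)).abs
  have := le_of_tendsto_of_tendsto' hlim (tendsto_const_div_natCast_add_one _) hp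
  exact sub_eq_zero.1 (abs_nonpos_iff.1 this)

theorem integral_eq_zero_of_tendsto_restrict (hφ : Continuous φ) (hφk : ∀ k, Continuous (φk k))
    (hφ_lim : TendstoUniformly φk φ atTop) (hν : ∀ k, Ergodic (fk k) (ν k : Measure X))
    (hint : ∀ k, 0 ≤ ∫ x, φk k x ∂(ν k : Measure X))
    (hm : ∀ (p : ℕ) (h : BoundedContinuousFunction X ℝ),
      Tendsto (fun k => ∫ x in neutralLocus (1 / ((p : ℝ) + 1)) (p + 1) (fk k) (φk k), h x
        ∂(ν k : Measure X)) atTop (𝓝 (∫ x, h x ∂(m p : Measure X))))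
    (hm₀ : ∀ h : BoundedContinuousFunction X ℝ,
      Tendsto (fun p => ∫ x, h x ∂(m p : Measure X)) atTop (𝓝 (∫ x, h x ∂(m₀ : Measure X)))) :
    ∫ x, φ x ∂(m₀ : Measure X) = 0 := by
  set Φ : BoundedContinuousFunction X ℝ := BoundedContinuousFunction.mkOfCompact ⟨φ, hφ⟩ with hΦ
  set Φk : ℕ → BoundedContinuousFunction X ℝ := fun k =>
    BoundedContinuousFunction.mkOfCompact ⟨φk k, hφk k⟩ with hΦk
  have hlim : ∀ p : ℕ, Tendsto (fun k => ∫ x in neutralLocus (1 / ((p : ℝ) + 1)) (p + 1) (fk k)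
      (φk k), φk k x ∂(ν k : Measure X)) atTop (𝓝 (∫ x, Φ x ∂(m p : Measure X))) := fun p =>
    tendsto_setIntegral_of_tendstoUniformly (fun k => Φ.integrable _)
      (fun k => (Φk k).integrable _) hφ_lim (hm p Φ)
  -- The lower bound must survive k → ∞, so it needs a constant independent of k.
  have hC : ∀ᶠ k in atTop, ∀ x, |φk k x| ≤ ‖Φ‖ + 1 := by
    filter_upwards [Metric.tendstoUniformly_iff.1 hφ_lim 1 one_pos] with k hk x
    have h1 := hk x
    have h2 := abs_le.1 (Φ.norm_coe_le_norm x)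
    change -‖Φ‖ ≤ φ x ∧ φ x ≤ ‖Φ‖ at h2
    rw [Real.dist_eq, abs_lt] at h1
    exact abs_le.2 ⟨by linarith, by linarith⟩
  have hup : ∀ p : ℕ, ∫ x, Φ x ∂(m p : Measure X) ≤ 1 * (1 / ((p : ℝ) + 1)) := fun p => by
    rw [one_mul]
    exact le_of_tendsto' (hlim p) fun k => setIntegral_neutralLocus_le
      (hν k).toMeasurePreserving (hφk k) (Φk k).norm_coe_le_norm (by positivity)
  have hlow : ∀ p : ℕ, -(‖Φ‖ + 1) * (1 / ((p : ℝ) + 1)) ≤ ∫ x, Φ x ∂(m p : Measure X) := by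
    intro p
    refine ge_of_tendsto (hlim p) ?_
    filter_upwards [hC] with k hk
    refine le_trans ?_ (neg_le_setIntegral_neutralLocus (hν k) (hφk k) hk (by positivity) (hint k))
    rw [measureReal_diff_preimage_eq (hν k).toMeasurePreserving
      (measurableSet_neutralLocus (hφk k)), neg_mul]
    gcongr
    exact measureReal_preimage_diff_neutralLocus_le (hφk k) (hν k).toMeasurePreserving _ p
  refine le_antisymm (le_of_tendsto_of_tendsto' (hm₀ Φ) (tendsto_const_div_natCast_add_one _) hup)
    (le_of_tendsto_of_tendsto' (tendsto_const_div_natCast_add_one _) (hm₀ Φ) hlow)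

end MainTheorem

theorem mainTheorem12 {X : Type*} [MetricSpace X] [CompactSpace X] [MeasurableSpace X]
    [BorelSpace X]
    (f : X ≃ₜ X) (fk : ℕ → X ≃ₜ X) (φ : X → ℝ) (φk : ℕ → X → ℝ)
    (hφ : Continuous φ) (hφk : ∀ k, Continuous (φk k))
    (hf_lim : TendstoUniformly (fun k x => fk k x) (fun x => f x) atTop)
    (hφ_lim : TendstoUniformly φk φ atTop)
    (ν : ℕ → ProbabilityMeasure X)
    (hν : ∀ k, Ergodic (fk k) (ν k : Measure X))
    (hint : ∀ k, 0 ≤ ∫ x, φk k x ∂(ν k : Measure X)) :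
    ∃ (κ : ℕ → ℕ) (m₀ m₁ : FiniteMeasure X), StrictMono κ ∧
      -- both limit measures are invariant
      MeasurePreserving f (m₀ : Measure X) (m₀ : Measure X) ∧
      MeasurePreserving f (m₁ : Measure X) (m₁ : Measure X) ∧
      -- weak-* convergence of the subsequence
      Tendsto (fun i => (ν (κ i)).toFiniteMeasure) atTop (𝓝 (m₀ + m₁)) ∧
      -- empirical measures over the neutral blocks and over their complement
      (∀ V₀ ∈ 𝓝 m₀, ∀ V₁ ∈ 𝓝 m₁, ∃ αstar : ℝ, 0 < αstar ∧ ∃ Lstar : ℝ, 1 ≤ Lstar ∧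
        ∀ α : ℝ, 0 < α → α < αstar → ∀ L : ℝ, Lstar ≤ L → ∃ istar : ℕ, ∀ i ≥ istar,
          ∀ᵐ x ∂(ν (κ i) : Measure X),
            empiricalMeasures (fk (κ i)) (neutralTimes α L x (fk (κ i)) (φk (κ i))) x ⊆ V₀ ∧
            empiricalMeasures (fk (κ i)) (neutralTimes α L x (fk (κ i)) (φk (κ i)))ᶜ x ⊆ V₁) ∧
      -- the integral of the limit function against the first measure
      ∫ x, φ x ∂(m₀ : Measure X) = 0 ∧
      -- the Birkhoff averages converge to a positive limit
      (∀ᵐ x ∂(m₁ : Measure X), ∃ l : ℝ, 0 < l ∧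
        Tendsto (fun n : ℕ => birkhoffAverage ℝ f φ n x) atTop (𝓝 l)) := by
  obtain ⟨κ, m₀, m₁, m, hκ, hm, hm₀, hlim, hnull⟩ := exists_subseq_tendsto_restrict ν
    -- Both parameters are tied to one index, giving a decreasing sequence cofinal among all (α, L).
    (fun k p => neutralLocus (1 / ((p : ℝ) + 1)) (p + 1) (fk k) (φk k))
    (fun k p => measurableSet_neutralLocus (hφk k))
    (fun k p q hpq => neutralLocus_mono (by gcongr) (by gcongr))
  have hκt := hκ.tendsto_atTop
  have hf_lim' : TendstoUniformly (fun i x => fk (κ i) x) (fun x => f x) atTop :=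
    fun u hu => hκt.eventually (hf_lim u hu)
  have hφ_lim' : TendstoUniformly (fun i => φk (κ i)) φ atTop :=
    fun u hu => hκt.eventually (hφ_lim u hu)
  have hinv₀ : MeasurePreserving f (m₀ : Measure X) (m₀ : Measure X) :=
    measurePreserving_of_tendsto_restrict (fun i => hφk (κ i)) hf_lim' (fun i => hν (κ i)) hm hm₀
  have hinv : MeasurePreserving f ((m₀ + m₁ : FiniteMeasure X) : Measure X)
      ((m₀ + m₁ : FiniteMeasure X) : Measure X) := by
    refine measurePreserving_of_forall_integral_comp_eq fun h => ?_
    have hlim' := FiniteMeasure.tendsto_iff_forall_integral_tendsto.1 hlim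
    have h1 := hlim' (h.compContinuous ⟨f, f.continuous⟩)
    have h2 := tendsto_setIntegral_of_tendstoUniformly (ν := fun i => ν (κ i))
      (S := fun _ => Set.univ) (hk := fun i x => h (fk (κ i) x)) (h := fun x => h (f x))
      (fun i => (h.compContinuous ⟨f, f.continuous⟩).integrable _)
      (fun i => (h.compContinuous ⟨fk (κ i), (fk (κ i)).continuous⟩).integrable _)
      ((CompactSpace.uniformContinuous_of_continuous h.continuous).comp_tendstoUniformly hf_lim')
      (by simp only [setIntegral_univ]; exact h1)
    refine tendsto_nhds_unique h2 ((hlim' h).congr fun i => ?_)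
    rw [setIntegral_univ]
    exact ((hν (κ i)).toMeasurePreserving.integral_comp
      (fk (κ i)).measurableEmbedding h).symm
  have hinv₁ : MeasurePreserving f (m₁ : Measure X) (m₁ : Measure X) := by
    refine measurePreserving_of_forall_integral_comp_eq fun h => ?_
    have h1 : ∫ x, h (f x) ∂((m₀ + m₁ : FiniteMeasure X) : Measure X) =
        ∫ x, h x ∂((m₀ + m₁ : FiniteMeasure X) : Measure X) :=
      hinv.integral_comp f.measurableEmbedding h
    have h2 : ∫ x, h (f x) ∂(m₀ : Measure X) = ∫ x, h x ∂(m₀ : Measure X) :=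
      hinv₀.integral_comp f.measurableEmbedding h
    have hi : ∀ m : Measure X, IsFiniteMeasure m → Integrable (fun x => h (f x)) m := fun m _ =>
      (h.compContinuous ⟨f, f.continuous⟩).integrable m
    rw [FiniteMeasure.toMeasure_add, integral_add_measure (h.integrable _) (h.integrable _),
      integral_add_measure (hi _ inferInstance) (hi _ inferInstance), h2] at h1
    exact add_left_cancel h1
  refine ⟨κ, m₀, m₁, hκ, hinv₀, hinv₁, hlim, ?_, ?_, ?_⟩
  · intro V₀ hV₀ V₁ hV₁
    have hN : ∀ (α L : ℝ) (i : ℕ), MeasurableSet (neutralLocus α L (fk (κ i)) (φk (κ i))) :=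
      fun α L i => measurableSet_neutralLocus (hφk (κ i))
    have h₀ := tendsto_restrictFinite_neutralFilter (ν := fun i => ν (κ i))
      (N := fun α L i => neutralLocus α L (fk (κ i)) (φk (κ i))) hN
      (fun i hα hL => neutralLocus_mono hα hL) hm hm₀
    have h₁ := tendsto_restrictFinite_compl (ν := fun q : (ℝ × ℝ) × ℕ => ν (κ q.2))
      (N := fun q => neutralLocus q.1.1 q.1.2 (fk (κ q.2)) (φk (κ q.2)))
      (fun q => hN q.1.1 q.1.2 q.2)
      (hlim.comp tendsto_snd_neutralFilter) h₀
    obtain ⟨αstar, hα, Lstar, hL, h⟩ := eventually_neutralFilter_iff.1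
      ((h₀.eventually_mem hV₀).and (h₁.eventually_mem hV₁))
    refine ⟨αstar, hα, Lstar, hL, fun α hα0 hα1 L hL1 => ?_⟩
    obtain ⟨istar, histar⟩ := h α hα0 hα1 L hL1
    refine ⟨istar, fun i hi => ?_⟩
    filter_upwards [ae_empiricalMeasures_subset (hφk (κ i)) (hν (κ i)) α L] with x hx
    exact ⟨hx.1.trans (Set.singleton_subset_iff.2 (histar i hi).1),
      hx.2.trans (Set.singleton_subset_iff.2 (histar i hi).2)⟩
  · exact integral_eq_zero_of_tendsto_restrict hφ (fun i => hφk (κ i)) hφ_lim' (fun i => hν (κ i))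
      (fun i => hint (κ i)) hm hm₀
  -- The limit `G` is taken with respect to `m₀ + m₁`, since the covering of `{x | G x ≤ 0}` needed
  -- for `hnull` must hold up to a null set of the sum.
  · obtain ⟨G, hGm, -, -, hG⟩ := ae_tendsto_birkhoffAverage hinv hφ.measurable
      (BoundedContinuousFunction.mkOfCompact ⟨φ, hφ⟩).norm_coe_le_norm
    obtain ⟨e, he⟩ := exists_surjective_nat (ℤ × ℤ)
    have hB : (m₁ : Measure X) {x | G x ≤ 0} = 0 := by
      refine hnull _ (measurableSet_le hGm measurable_const) fun p =>
        ⟨fun K => strictNeutralLocus (1 / ((p : ℝ) + 1) / 2) (p + 1) f φ (e K).1 (e K).2,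
          fun K => isOpen_strictNeutralLocus hφ _ _ _ _,
          fun K => eventually_strictNeutralLocus_subset hφ hf_lim hφ_lim (by positivity) _ _ _, ?_⟩
      rw [he.iUnion_comp fun c : ℤ × ℤ =>
        strictNeutralLocus (1 / ((p : ℝ) + 1) / 2) (p + 1) f φ c.1 c.2]
      exact measure_diff_iUnion_strictNeutralLocus_eq_zero hinv hφ hGm hG (by positivity) _
    have hG₁ : ∀ᵐ x ∂(m₁ : Measure X),
        Tendsto (fun n => birkhoffAverage ℝ f φ n x) atTop (𝓝 (G x)) := by
      rw [FiniteMeasure.toMeasure_add, ae_add_measure_iff] at hG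
      exact hG.2
    filter_upwards [hG₁, measure_eq_zero_iff_ae_notMem.1 hB] with x hx hx0
    exact ⟨G x, not_le.1 hx0, hx⟩
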